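/- Consider the fixed effects panel model $$y_{it}=\alpha+x_{it}'\beta+\mu_i+\nu_{it},\qquad 1\le i\le n,\ 1\le t\le T,$$ with regressors $x_{it}\in\mathbb R^k$ ($k$ fixed, possibly random), individual effects $\mu_i$ (arbitrary random variables) and unobserved errors $\nu_{it}$. Write $\tilde z_{it}=z_{it}-\frac1T\sum_{s=1}^T z_{is}$ for centring over time, $X_i=(\tilde x_{i1},\dots,\tilde x_{iT})$ (a $k\times T$ matrix), and assume that, almost surely, $\sum_{i,t}\tilde x_{it}\tilde x_{it}'$ is invertible for all large $T$, so that the OLS estimator $$\hat\beta=\Big(\sum_{t=1}^T\sum_{i=1}^n\tilde x_{it}\tilde x_{it}'\Big)^{-1}\sum_{t=1}^T\sum_{i=1}^n\tilde x_{it}\tilde y_{it}$$ and the residuals $\hat\nu_{it}=\tilde y_{it}-\tilde x_{it}'\hat\beta$ are defined. Put $\hat S_T=\frac1T\sum_t\hat\nu_t\hat\nu_t'$ with $\hat\nu_t=(\hat\nu_{1t},\dots,\hat\nu_{nt})'$, $\hat R_T=\hat D_T^{-1/2}\hat S_T\hat D_T^{-1/2}$ with $\hat D_T=\mathrm{diag}(\hat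 S_T)$, and define $S_T$, $D_T=\mathrm{diag}(S_T)$ and $R_T=D_T^{-1/2}S_TD_T^{-1/2}$ in the same way from the centred errors $\tilde\nu_{it}$. Let $E_k=\{u\in\mathbb R^k:\ u_1+\dots+u_k=0\}$. Suppose: (SIM-L) $T\to\infty$ and $n=n(T)$ with $n/T\to c\in(0,\infty)$. (B1) The error vectors $\nu_t=(\nu_{1t},\nu_{2t},\dots)$, $t\ge1$, are i.i.d. with mean zero, and $\sup_{i,t}E|\nu_{it}|^6<\infty$. (B2) (i) The regressors $\{x_{it}\}$ are independent of the errors $\{\nu_{it}\}$. (ii) There are constants $a_1,a_2>0$ such that, almost surely, for all large $T$, all $i\le n(T)$ and all nonzero $u\in E_k$, $a_1\|u\|^2\le\frac1T u'X_iX_i'u\le a_2\|u\|^2$. (iii) For every $i$ and every nonzero $u\in E_k$, almost surely, $\max_{1\le t\le T}\langle u,\tilde x_{it}\rangle^2/(u'X_iX_i'u)\to0$ as $T\to\infty$. ($H_0$) The error series $(\nu_{it})_{t\ge1}$ are independent across the units $i$. (Non-degeneracy) $\inf_{i,t}\mathrm{Var}(\nu_{it})>0$. Then $\mathrm{tr}(\hat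 R_T^4)-\mathrm{tr}(R_T^4)=o_p(1)$, that is, the difference converges to $0$ in probability as $T\to\infty$. -/

import Mathlib

open MeasureTheory ProbabilityTheory Filter Topology Matrix

noncomputable section

namespace Panel

/-- Centring over the time periods `0, …, T - 1`:  `z̃_t = z_t - T⁻¹ ∑_{s < T} z_s`.
Units and periods are numbered from `0`. -/
def centered {M : Type*} [AddCommGroup M] [Module ℝ M] (T : ℕ) (z : ℕ → M) (t : ℕ) : M :=
  z t - (T : ℝ)⁻¹ • ∑ s ∈ Finset.range T, z s

/-- The `k × T` design matrix `X_i = (x̃_{i1}, …, x̃_{iT})` of one unit with regressors `xi`. -/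
def designMatrix {k : ℕ} (T : ℕ) (xi : ℕ → Fin k → ℝ) : Matrix (Fin k) (Fin T) ℝ :=
  Matrix.of fun l t => centered T xi t l

/-- The `k × k` matrix `X X' = ∑_t ∑_i x̃_{it} x̃_{it}'`. -/
def gram {k : ℕ} (n T : ℕ) (x : ℕ → ℕ → Fin k → ℝ) : Matrix (Fin k) (Fin k) ℝ :=
  ∑ t ∈ Finset.range T, ∑ i ∈ Finset.range n,
    vecMulVec (centered T (x i) t) (centered T (x i) t)

/-- The OLS estimator `β̂ = (∑_t ∑_i x̃_{it} x̃_{it}')⁻¹ (∑_t ∑_i x̃_{it} ỹ_{it})`. -/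
def olsEstimator {k : ℕ} (n T : ℕ) (y : ℕ → ℕ → ℝ) (x : ℕ → ℕ → Fin k → ℝ) : Fin k → ℝ :=
  (gram n T x)⁻¹ *ᵥ
    ∑ t ∈ Finset.range T, ∑ i ∈ Finset.range n, centered T (y i) t • centered T (x i) t

/-- The OLS residuals `ν̂_{it} = ỹ_{it} - x̃_{it}' β̂`. -/
def residual {k : ℕ} (n T : ℕ) (y : ℕ → ℕ → ℝ) (x : ℕ → ℕ → Fin k → ℝ) (i t : ℕ) : ℝ :=
  centered T (y i) t - centered T (x i) t ⬝ᵥ olsEstimator n T y x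

/-- The sample covariance matrix `T⁻¹ ∑_t e_t e_t'` of the vectors `e_t = (e_{1t}, …, e_{nt})'`. -/
def sampleCov (n T : ℕ) (e : ℕ → ℕ → ℝ) : Matrix (Fin n) (Fin n) ℝ :=
  (T : ℝ)⁻¹ • ∑ t ∈ Finset.range T,
    vecMulVec (fun i : Fin n => e i t) (fun i : Fin n => e i t)

/-- `diag(S)^{-1/2}`. -/
def diagInvSqrt {n : ℕ} (S : Matrix (Fin n) (Fin n) ℝ) : Matrix (Fin n) (Fin n) ℝ :=
  Matrix.diagonal fun i => (√(S i i))⁻¹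

/-- The sample correlation matrix `D^{-1/2} S D^{-1/2}`, with `S` the sample covariance matrix
and `D = diag(S)`. -/
def sampleCorr (n T : ℕ) (e : ℕ → ℕ → ℝ) : Matrix (Fin n) (Fin n) ℝ :=
  diagInvSqrt (sampleCov n T e) * sampleCov n T e * diagInvSqrt (sampleCov n T e)

/-- `R̂_T`: the sample correlation matrix of the OLS residuals. -/
def residualCorr {k : ℕ} (n T : ℕ) (y : ℕ → ℕ → ℝ) (x : ℕ → ℕ → Fin k → ℝ) :
    Matrix (Fin n) (Fin n) ℝ :=
  sampleCorr n T (residual n T y x)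

/-- `R_T`: the sample correlation matrix of the centred errors. -/
def errorCorr (n T : ℕ) (ν : ℕ → ℕ → ℝ) : Matrix (Fin n) (Fin n) ℝ :=
  sampleCorr n T (fun i t => centered T (ν i) t)

/-- `E_k`: the vectors of `ℝ^k` orthogonal to the constant vector. -/
def sumZero (k : ℕ) : Set (Fin k → ℝ) := {u | ∑ l, u l = 0}

variable {Ω : Type*} [MeasurableSpace Ω]

/-- Assumption (B1): the error vectors `ν_t = (ν_{it})_i` are i.i.d. over time, with mean zero and
uniformly bounded sixth moments. -/
structure AssumptionB1 (P : Measure Ω) (ν : ℕ → ℕ → Ω → ℝ) : Prop where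
  measurable : ∀ i t, Measurable (ν i t)
  indep : iIndepFun (fun (t : ℕ) (ω : Ω) (i : ℕ) => ν i t ω) P
  identDistrib : ∀ s t : ℕ, IdentDistrib (fun (ω : Ω) (i : ℕ) => ν i s ω)
    (fun (ω : Ω) (i : ℕ) => ν i t ω) P P
  mean_zero : ∀ i t, ∫ ω, ν i t ω ∂P = 0
  sixth_moment : ∃ C₂ : ℝ, 0 < C₂ ∧
    ∀ i t, Integrable (fun ω => |ν i t ω| ^ 6) P ∧ ∫ ω, |ν i t ω| ^ 6 ∂P ≤ C₂

/-- The null hypothesis: the error series `(ν_{it})_t` are independent across the units `i`. -/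
def NullHypothesis (P : Measure Ω) (ν : ℕ → ℕ → Ω → ℝ) : Prop :=
  iIndepFun (fun (i : ℕ) (ω : Ω) (t : ℕ) => ν i t ω) P

/-- Assumption (B2), for a panel with `n T` units when there are `T` periods. The regressors may be
random, so the conditions on the design hold almost surely. The bounds in (ii) are for large `T`:
they cannot hold for `T = 1`, where the centred regressors vanish. Here `‖u‖² = u ⬝ᵥ u`. -/
structure AssumptionB2 {k : ℕ} (P : Measure Ω) (n : ℕ → ℕ) (x : ℕ → ℕ → Ω → Fin k → ℝ)
    (ν : ℕ → ℕ → Ω → ℝ) : Prop where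
  measurable : ∀ i t, Measurable (x i t)
  indep : IndepFun (fun (ω : Ω) (p : ℕ × ℕ) => x p.1 p.2 ω)
    (fun (ω : Ω) (p : ℕ × ℕ) => ν p.1 p.2 ω) P
  bounds : ∃ a₁ a₂ : ℝ, 0 < a₁ ∧ 0 < a₂ ∧ ∀ᵐ ω ∂P, ∀ᶠ T : ℕ in atTop,
    ∀ i < n T, ∀ u ∈ sumZero k, u ≠ 0 →
      a₁ * (u ⬝ᵥ u) ≤ (T : ℝ)⁻¹ * (u ⬝ᵥ
          ((designMatrix T fun t => x i t ω) * (designMatrix T fun t => x i t ω)ᵀ) *ᵥ u) ∧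
      (T : ℝ)⁻¹ * (u ⬝ᵥ
          ((designMatrix T fun t => x i t ω) * (designMatrix T fun t => x i t ω)ᵀ) *ᵥ u)
        ≤ a₂ * (u ⬝ᵥ u)
  negligible : ∀ i, ∀ u ∈ sumZero k, u ≠ 0 → ∀ᵐ ω ∂P, Tendsto (fun T : ℕ =>
      (⨆ t : Fin T, (u ⬝ᵥ centered T (fun s => x i s ω) t) ^ 2) /
        (u ⬝ᵥ ((designMatrix T fun t => x i t ω) * (designMatrix T fun t => x i t ω)ᵀ) *ᵥ u))
    atTop (𝓝 0)

end Panel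

end

open MeasureTheory ProbabilityTheory Filter Topology Matrix

noncomputable section

/-! Centring removes the intercept and the individual effects, and OLS turns the centred errors `Z`
into `Z + D` with `D = -∑ c_l U_l`. The `k` panels `U_l` depend on the regressors only, have
Frobenius norm one and have centred rows, and `c_l = ⟨U_l, ν⟩`
(`exists_residual_eq_sub_projection`). The errors are uncorrelated with bounded variances, so the
`c_l`, and with them the Frobenius norm of `D`, are `O_p(1)`, whereas the rows of `Z` have length of
order at least `√T`.

View `tr R ^ 4` as a function of the panel `Z`. If its rows have length at least `ρ` and the
row-normalized panel has spectral norm at most `K`, a Taylor expansion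
(`abs_trace_rowCorr_add_sub_le`) shows that the statistic changes by `8 ⟨G, D⟩ + O(K ^ 6 ‖D‖² /
ρ²)`, where `G = corrGrad Z` has spectral norm `O(K ^ 7 / ρ)`.

Cauchy-Schwarz does not make the linear term small; symmetry does. The periods are exchangeable,
permuting the columns of `Z` permutes those of `G`, and the rows of `G` and `U_l` sum to zero. Hence
the second moments of the entries of `G` factor into a multiple of the centring matrix over time and
one matrix over units, and `E ⟨G, U_l⟩²` is at most `sup ‖G‖² / (T - 1)`, which is `O(K ^ 14 / T ^
2)` (`integral_sq_sum_mul_le_of_exchangeable`).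

It remains to control `ρ` and `K`. An exponential lower-tail bound and a union over units give `ρ`
of order `√T`. Adding the periods one at a time to a truncated second moment matrix gives `tr (νν')
^ 4 = O_p(T ^ 5)`, so `K` of order `T ^ (1/8)` is admissible. Then `K ^ 6 / T` and `K ^ 14 / T ^ 2`
are both of order `T ^ (-1/4)`. All bounds are uniform over fixed regressors, so independence and
Fubini's theorem cover random ones. -/

namespace Panel

/-! ### Frobenius and spectral norms -/

section MatrixNorms

open scoped Matrix.Norms.L2Operator

variable {ι τ σ : Type*} [Fintype ι] [Fintype τ] [Fintype σ]

/-- The Frobenius norm. -/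
def frob (A : Matrix ι τ ℝ) : ℝ := √(∑ i, ∑ t, A i t ^ 2)

/-- The Frobenius inner product. -/
def finner (A B : Matrix ι τ ℝ) : ℝ := ∑ i, ∑ t, A i t * B i t

lemma frob_nonneg (A : Matrix ι τ ℝ) : 0 ≤ frob A := Real.sqrt_nonneg _

lemma frob_sq (A : Matrix ι τ ℝ) : frob A ^ 2 = ∑ i, ∑ t, A i t ^ 2 :=
  Real.sq_sqrt (by positivity)

lemma frob_eq_norm (A : Matrix ι τ ℝ) :
    frob A = ‖(WithLp.toLp 2 fun p : ι × τ => A p.1 p.2 : EuclideanSpace ℝ (ι × τ))‖ := by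
  rw [EuclideanSpace.norm_eq, frob, Fintype.sum_prod_type]
  simp

lemma frob_add_le (A B : Matrix ι τ ℝ) : frob (A + B) ≤ frob A + frob B := by
  rw [frob_eq_norm, frob_eq_norm, frob_eq_norm]
  exact norm_add_le (WithLp.toLp 2 fun p : ι × τ => A p.1 p.2 : EuclideanSpace ℝ (ι × τ))
    (WithLp.toLp 2 fun p : ι × τ => B p.1 p.2 : EuclideanSpace ℝ (ι × τ))

lemma abs_finner_le (A B : Matrix ι τ ℝ) : |finner A B| ≤ frob A * frob B := by
  apply abs_le_of_sq_le_sq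
  · rw [mul_pow, frob_sq, frob_sq, finner]
    simp_rw [← Fintype.sum_prod_type']
    exact Finset.sum_mul_sq_le_sq_mul_sq _ _ _
  · exact mul_nonneg (frob_nonneg _) (frob_nonneg _)

lemma finner_eq_trace (A B : Matrix ι τ ℝ) : finner A B = (A * Bᵀ).trace := by
  simp [finner, trace, mul_apply]

lemma finner_neg_right (A B : Matrix ι τ ℝ) : finner A (-B) = -finner A B := by
  simp [finner]

lemma finner_smul_right (c : ℝ) (A B : Matrix ι τ ℝ) : finner A (c • B) = c * finner A B := by
  simp [finner, Finset.mul_sum, mul_left_comm]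

lemma finner_sum_right {κ : Type*} (s : Finset κ) (A : Matrix ι τ ℝ) (B : κ → Matrix ι τ ℝ) :
    finner A (∑ l ∈ s, B l) = ∑ l ∈ s, finner A (B l) := by
  simp_rw [finner_eq_trace, transpose_sum, Matrix.mul_sum, trace_sum]

lemma finner_self (A : Matrix ι τ ℝ) : finner A A = frob A ^ 2 := by
  rw [frob_sq]
  simp [finner, sq]

lemma finner_comm (A B : Matrix ι τ ℝ) : finner A B = finner B A := by
  simp [finner, mul_comm]

lemma frob_transpose (A : Matrix ι τ ℝ) : frob Aᵀ = frob A := by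
  rw [frob, frob, Finset.sum_comm]; rfl

lemma abs_trace_mul_le (A : Matrix ι τ ℝ) (B : Matrix τ ι ℝ) :
    |(A * B).trace| ≤ frob A * frob B := by
  have := abs_finner_le A Bᵀ
  rwa [finner_eq_trace, transpose_transpose, frob_transpose] at this

variable [DecidableEq ι] [DecidableEq τ] [DecidableEq σ]

set_option linter.unusedSectionVars false

lemma opNorm_transpose (A : Matrix ι τ ℝ) : ‖Aᵀ‖ = ‖A‖ := by
  rw [← conjTranspose_eq_transpose_of_trivial, l2_opNorm_conjTranspose]

lemma sum_mulVec_sq_le (A : Matrix ι τ ℝ) (v : τ → ℝ) :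
    ∑ i, (A *ᵥ v) i ^ 2 ≤ ‖A‖ ^ 2 * ∑ t, v t ^ 2 := by
  have h := l2_opNorm_mulVec A (WithLp.toLp 2 v)
  have h2 := pow_le_pow_left₀ (norm_nonneg _) h 2
  rw [mul_pow, EuclideanSpace.norm_sq_eq, EuclideanSpace.norm_sq_eq] at h2
  simpa using h2

lemma opNorm_le_of_sum_mulVec_sq_le {A : Matrix ι τ ℝ} {K : ℝ} (hK : 0 ≤ K)
    (h : ∀ v : τ → ℝ, ∑ i, (A *ᵥ v) i ^ 2 ≤ K ^ 2 * ∑ t, v t ^ 2) : ‖A‖ ≤ K := by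
  rw [l2_opNorm_def]
  refine ContinuousLinearMap.opNorm_le_bound _ hK fun v => ?_
  apply le_of_sq_le_sq _ (by positivity)
  have := h v.ofLp
  rw [mul_pow, EuclideanSpace.norm_sq_eq, EuclideanSpace.norm_sq_eq]
  simpa using this

lemma opNorm_le_frob (A : Matrix ι τ ℝ) : ‖A‖ ≤ frob A := by
  refine opNorm_le_of_sum_mulVec_sq_le (frob_nonneg A) fun v => ?_
  rw [frob_sq, Finset.sum_mul]
  exact Finset.sum_le_sum fun i _ => Finset.sum_mul_sq_le_sq_mul_sq _ _ _

/-- The squared Frobenius norm is a sum over columns, and `A` acts on each column of `B` separately.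
-/
lemma frob_mul_le_opNorm_mul (A : Matrix ι τ ℝ) (B : Matrix τ σ ℝ) :
    frob (A * B) ≤ ‖A‖ * frob B := by
  apply le_of_sq_le_sq _ (mul_nonneg (norm_nonneg _) (frob_nonneg _))
  rw [mul_pow, frob_sq, frob_sq, Finset.sum_comm, Finset.sum_comm (s := (Finset.univ : Finset τ)),
    Finset.mul_sum]
  exact Finset.sum_le_sum fun j _ => sum_mulVec_sq_le A fun t => B t j

lemma frob_mul_le_mul_opNorm (A : Matrix ι τ ℝ) (B : Matrix τ σ ℝ) :
    frob (A * B) ≤ frob A * ‖B‖ := by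
  rw [← frob_transpose, transpose_mul, mul_comm, ← opNorm_transpose, ← frob_transpose A]
  exact frob_mul_le_opNorm_mul _ _

lemma opNorm_mul_transpose_self_le (A : Matrix ι τ ℝ) : ‖A * Aᵀ‖ ≤ ‖A‖ ^ 2 := by
  refine (l2_opNorm_mul _ _).trans_eq ?_
  rw [opNorm_transpose, sq]

/-- For `A` positive semidefinite of the form `Z Z'`, the fourth power of the spectral norm is at
most `tr A ^ 4`. -/
lemma opNorm_pow_eight_le_trace (Z : Matrix ι τ ℝ) : ‖Z‖ ^ 8 ≤ ((Z * Zᵀ) ^ 4).trace := by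
  have h1 : ‖Z * Zᵀ‖ = ‖Z‖ ^ 2 := by
    have := l2_opNorm_conjTranspose_mul_self Zᴴ
    rw [conjTranspose_conjTranspose, l2_opNorm_conjTranspose] at this
    rw [sq, ← this, conjTranspose_eq_transpose_of_trivial]
  have hs : (Z * Zᵀ)ᵀ = Z * Zᵀ := by simp
  have h2 : ‖(Z * Zᵀ) ^ 2‖ = ‖Z * Zᵀ‖ ^ 2 := by
    have := l2_opNorm_conjTranspose_mul_self (Z * Zᵀ)
    rw [conjTranspose_eq_transpose_of_trivial, hs] at this
    rw [sq, sq, this]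
  -- By symmetry of `Z Z'` the Frobenius norm of its square is the root of the trace in question,
  -- and the C*-identity identifies the spectral norm with `‖Z‖ ^ 4`.
  have h3 := opNorm_le_frob ((Z * Zᵀ) ^ 2)
  have h4 : frob ((Z * Zᵀ) ^ 2) ^ 2 = ((Z * Zᵀ) ^ 4).trace := by
    rw [← finner_self, finner_eq_trace, transpose_pow, hs, ← pow_add]
  rw [← h4]
  calc ‖Z‖ ^ 8 = (‖(Z * Zᵀ) ^ 2‖) ^ 2 := by rw [h2, h1]; ring
    _ ≤ _ := pow_le_pow_left₀ (norm_nonneg _) h3 2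

end MatrixNorms

/-! ### Perturbation of the trace of a fourth power -/

section TraceExpansion

open scoped Matrix.Norms.L2Operator

variable {ι τ : Type*} [Fintype ι] [Fintype τ] [DecidableEq ι] [DecidableEq τ]

/-- The trace is invariant under rotation, so the sixteen words in `R` and `H` fall into six cyclic
classes. -/
lemma trace_add_pow_four (R H : Matrix ι ι ℝ) :
    ((R + H) ^ 4).trace = (R ^ 4).trace + 4 * (R ^ 3 * H).trace + 4 * (R ^ 2 * H * H).trace
      + 2 * (R * H * R * H).trace + 4 * (R * H * H * H).trace + (H ^ 4).trace := by
  have e : (R + H) ^ 4 = R ^ 4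
      + (R * R * R * H + R * R * H * R + R * H * R * R + H * R * R * R)
      + (R * R * H * H + R * H * H * R + H * H * R * R + H * R * R * H)
      + (R * H * R * H + H * R * H * R)
      + (R * H * H * H + H * R * H * H + H * H * R * H + H * H * H * R) + H ^ 4 := by
    noncomm_ring
  have c (A B : Matrix ι ι ℝ) : (A * B).trace = (B * A).trace := trace_mul_comm A B
  rw [e]
  simp only [trace_add]
  have a1 : (R * R * H * R).trace = (R * R * R * H).trace := by
    rw [c]; simp only [Matrix.mul_assoc]
  have a2 : (R * H * R * R).trace = (R * R * R * H).trace := by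
    rw [Matrix.mul_assoc, c]; simp only [Matrix.mul_assoc]
  have a3 : (H * R * R * R).trace = (R * R * R * H).trace := by
    rw [Matrix.mul_assoc, Matrix.mul_assoc, c]; simp only [Matrix.mul_assoc]
  have b1 : (R * H * H * R).trace = (R * R * H * H).trace := by
    rw [c]; simp only [Matrix.mul_assoc]
  have b2 : (H * H * R * R).trace = (R * R * H * H).trace := by
    rw [Matrix.mul_assoc, c]; simp only [Matrix.mul_assoc]
  have b3 : (H * R * R * H).trace = (R * R * H * H).trace := by
    rw [Matrix.mul_assoc, Matrix.mul_assoc, c]; simp only [Matrix.mul_assoc]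
  have d1 : (H * R * H * R).trace = (R * H * R * H).trace := by
    rw [c]; simp only [Matrix.mul_assoc]
  have f1 : (H * R * H * H).trace = (R * H * H * H).trace := by
    rw [Matrix.mul_assoc, Matrix.mul_assoc, c]; simp only [Matrix.mul_assoc]
  have f2 : (H * H * R * H).trace = (R * H * H * H).trace := by
    rw [Matrix.mul_assoc, c]; simp only [Matrix.mul_assoc]
  have f3 : (H * H * H * R).trace = (R * H * H * H).trace := by
    rw [c]; simp only [Matrix.mul_assoc]
  have g1 : R ^ 3 * H = R * R * R * H := by noncomm_ring
  have g2 : R ^ 2 * H * H = R * R * H * H := by noncomm_ring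
  rw [a1, a2, a3, b1, b2, b3, d1, f1, f2, f3, g1, g2]
  ring

lemma opNorm_pow_le (R : Matrix ι ι ℝ) {r : ℝ} (h : ‖R‖ ≤ r) (j : ℕ) (hj : 0 < j) :
    ‖R ^ j‖ ≤ r ^ j := by
  refine (norm_pow_le' R hj).trans ?_
  gcongr

/-- In a word with at least two factors `H`, two of them are measured in the Frobenius norm and all
other factors in the spectral norm. No dimension enters. -/
lemma abs_trace_add_pow_four_sub_le (R H : Matrix ι ι ℝ) {r e : ℝ} (hr : ‖R‖ ≤ r)
    (he : frob H ≤ e) :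
    |((R + H) ^ 4).trace - (R ^ 4).trace - 4 * (R ^ 3 * H).trace|
      ≤ 6 * r ^ 2 * e ^ 2 + 4 * r * e ^ 3 + e ^ 4 := by
  have hr0 : 0 ≤ r := (norm_nonneg _).trans hr
  have he0 : 0 ≤ e := (frob_nonneg _).trans he
  have hH : ‖H‖ ≤ e := (opNorm_le_frob H).trans he
  have t (A : Matrix ι ι ℝ) (a : ℝ) (hA : frob A ≤ a) : |(A * H).trace| ≤ a * e :=
    (abs_trace_mul_le A H).trans (by
      have := (frob_nonneg A).trans hA
      have := frob_nonneg H
      gcongr)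
  have m (A B : Matrix ι ι ℝ) (a b : ℝ) (hA : frob A ≤ a) (hB : ‖B‖ ≤ b) :
      frob (A * B) ≤ a * b :=
    (frob_mul_le_mul_opNorm A B).trans (by
      have := (frob_nonneg A).trans hA
      gcongr)
  have m' (A B : Matrix ι ι ℝ) (a b : ℝ) (hA : ‖A‖ ≤ a) (hB : frob B ≤ b) :
      frob (A * B) ≤ a * b :=
    (frob_mul_le_opNorm_mul A B).trans (by
      have := frob_nonneg B
      have := (norm_nonneg A).trans hA
      gcongr)
  have h1 := t (R ^ 2 * H) _ (m' _ _ _ _ (opNorm_pow_le R hr 2 two_pos) he)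
  have hRH := m' _ _ _ _ hr he
  have h2 := t (R * H * R) _ (m _ _ _ _ hRH hr)
  have h3 := t (R * H * H) _ (m _ _ _ _ hRH hH)
  have h4 := t (H * H * H) _ (m _ _ _ _ (m _ _ _ _ he hH) hH)
  have h5 : H ^ 4 = H * H * H * H := by noncomm_ring
  rw [trace_add_pow_four, h5]
  rw [abs_le] at *
  constructor <;> nlinarith

end TraceExpansion

/-! ### Taylor expansion of `v / ‖v‖` -/

section Normalize

set_option linter.unusedSectionVars false

variable {V : Type*} [NormedAddCommGroup V] [InnerProductSpace ℝ V]

lemma norm_add_ge_half {a d : V} (h : ‖d‖ ≤ ‖a‖ / 2) : ‖a‖ / 2 ≤ ‖a + d‖ := by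
  have := norm_sub_norm_le a (-d)
  rw [sub_neg_eq_add, norm_neg] at this
  linarith

lemma abs_norm_add_sub_norm_le (a d : V) : |‖a + d‖ - ‖a‖| ≤ ‖d‖ := by
  simpa using abs_norm_sub_norm_le (a + d) a

lemma abs_inv_norm_add_sub_le {a d : V} (ha : a ≠ 0) (h : ‖d‖ ≤ ‖a‖ / 2) :
    |‖a + d‖⁻¹ - ‖a‖⁻¹| ≤ ‖d‖ / (‖a + d‖ * ‖a‖) := by
  have hr : 0 < ‖a‖ := norm_pos_iff.2 ha
  have hρ : 0 < ‖a + d‖ := by linarith [norm_add_ge_half h]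
  rw [inv_sub_inv hρ.ne' hr.ne', abs_div, abs_of_pos (mul_pos hρ hr)]
  gcongr
  rw [abs_sub_comm]
  exact abs_norm_add_sub_norm_le a d

/-- Normalizing vectors is Lipschitz away from the origin. -/
lemma norm_normalize_add_sub_le {a d : V} (ha : a ≠ 0) (h : ‖d‖ ≤ ‖a‖ / 2) :
    ‖‖a + d‖⁻¹ • (a + d) - ‖a‖⁻¹ • a‖ ≤ 2 * (‖d‖ / ‖a‖) := by
  have hr : 0 < ‖a‖ := norm_pos_iff.2 ha
  have hρ : 0 < ‖a + d‖ := by linarith [norm_add_ge_half h]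
  have e : ‖a + d‖⁻¹ • (a + d) - ‖a‖⁻¹ • a
      = (‖a + d‖⁻¹ - ‖a‖⁻¹) • (a + d) + ‖a‖⁻¹ • d := by module
  rw [e]
  refine (norm_add_le _ _).trans ?_
  rw [norm_smul, norm_smul, norm_inv, norm_norm, Real.norm_eq_abs]
  calc _ ≤ ‖d‖ / (‖a + d‖ * ‖a‖) * ‖a + d‖ + ‖a‖⁻¹ * ‖d‖ := by
        gcongr
        exact abs_inv_norm_add_sub_le ha h
    _ = _ := by field_simp; ring

/-- The second order remainder of the normalization of vectors. -/
lemma norm_normalize_add_sub_sub_le {a d : V} (ha : a ≠ 0) (h : ‖d‖ ≤ ‖a‖ / 2) :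
    ‖‖a + d‖⁻¹ • (a + d) - ‖a‖⁻¹ • a - (‖a‖⁻¹ • d - (inner ℝ a d / ‖a‖ ^ 3) • a)‖
      ≤ 8 * (‖d‖ / ‖a‖) ^ 2 := by
  have hr : 0 < ‖a‖ := norm_pos_iff.2 ha
  have hh := norm_add_ge_half h
  have hρ : 0 < ‖a + d‖ := by linarith
  have e : ‖a + d‖⁻¹ • (a + d) - ‖a‖⁻¹ • a - (‖a‖⁻¹ • d - (inner ℝ a d / ‖a‖ ^ 3) • a)
      = (‖a + d‖⁻¹ - ‖a‖⁻¹) • d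
        + (‖a + d‖⁻¹ - ‖a‖⁻¹ + inner ℝ a d / ‖a‖ ^ 3) • a := by module
  have h1 := abs_inv_norm_add_sub_le ha h
  have h2 := abs_norm_add_sub_norm_le a d
  have hs := abs_real_inner_le_norm a d
  have hsq := norm_add_sq_real a d
  have hd0 := norm_nonneg d
  rw [e]
  refine (norm_add_le _ _).trans ?_
  rw [norm_smul, norm_smul, Real.norm_eq_abs, Real.norm_eq_abs]
  generalize ‖a + d‖ = ρ at *
  generalize ‖a‖ = r at *
  generalize ‖d‖ = δ at *
  generalize inner ℝ a d = s at *
  have hb : |ρ⁻¹ - r⁻¹| ≤ 2 * δ / r ^ 2 := by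
    refine h1.trans ?_
    rw [div_le_div_iff₀ (by positivity) (by positivity)]
    nlinarith [mul_nonneg hd0 (mul_nonneg hr.le (sub_nonneg.2 hh))]
  -- Both inverse lengths are compared through `ρ ^ 2 - r ^ 2 = 2 s + δ ^ 2`. The part linear in `s`
  -- cancels up to the factor `ρ - r`, which is itself at most `δ`.
  have e2 : ρ⁻¹ - r⁻¹ + s / r ^ 3
      = s * (ρ - r) * ((ρ + 2 * r) / (r ^ 3 * ρ * (r + ρ))) - δ ^ 2 * (r * ρ * (r + ρ))⁻¹ := by
    field_simp
    linear_combination (-r ^ 2) * hsq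
  have hk1 : (ρ + 2 * r) / (r ^ 3 * ρ * (r + ρ)) ≤ 4 / r ^ 4 := by
    rw [div_le_div_iff₀ (by positivity) (by positivity)]
    have : (ρ + 2 * r) * r ≤ 4 * (ρ * (r + ρ)) := by nlinarith
    calc (ρ + 2 * r) * r ^ 4 = r ^ 3 * ((ρ + 2 * r) * r) := by ring
      _ ≤ r ^ 3 * (4 * (ρ * (r + ρ))) := by gcongr
      _ = _ := by ring
  have hk2 : (r * ρ * (r + ρ))⁻¹ ≤ 2 / r ^ 3 := by
    rw [inv_eq_one_div, div_le_div_iff₀ (by positivity) (by positivity)]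
    have : r ^ 2 ≤ 2 * (ρ * (r + ρ)) := by nlinarith
    calc 1 * r ^ 3 = r * r ^ 2 := by ring
      _ ≤ r * (2 * (ρ * (r + ρ))) := by gcongr
      _ = _ := by ring
  have hc : |ρ⁻¹ - r⁻¹ + s / r ^ 3| ≤ r * δ * δ * (4 / r ^ 4) + δ ^ 2 * (2 / r ^ 3) := by
    rw [e2]
    refine (abs_sub _ _).trans ?_
    rw [abs_mul, abs_mul, abs_mul, abs_of_nonneg (by positivity : 0 ≤ δ ^ 2),
      abs_of_nonneg (by positivity : 0 ≤ (ρ + 2 * r) / (r ^ 3 * ρ * (r + ρ))),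
      abs_of_nonneg (by positivity : 0 ≤ (r * ρ * (r + ρ))⁻¹)]
    gcongr
  calc _ ≤ 2 * δ / r ^ 2 * δ + (r * δ * δ * (4 / r ^ 4) + δ ^ 2 * (2 / r ^ 3)) * r := by gcongr
    _ = 8 * (δ / r) ^ 2 := by field_simp; ring

end Normalize

/-! ### First order expansion of the statistic in the data panel -/

section RowNormalize

set_option linter.unusedSectionVars false

open scoped Matrix.Norms.L2Operator

variable {ι τ : Type*} [Fintype ι] [Fintype τ]

/-- The Euclidean norm of a row. -/
def rowNorm (Z : Matrix ι τ ℝ) (i : ι) : ℝ := √(∑ t, Z i t ^ 2)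

/-- The matrix with its rows scaled to unit length. -/
def normRows (Z : Matrix ι τ ℝ) : Matrix ι τ ℝ := of fun i t => (rowNorm Z i)⁻¹ * Z i t

/-- The correlation matrix of the rows. -/
def rowCorr (Z : Matrix ι τ ℝ) : Matrix ι ι ℝ := normRows Z * (normRows Z)ᵀ

variable [DecidableEq ι]

/-- An eighth of the gradient of `Z ↦ tr (rowCorr Z ^ 4)`. -/
def corrGrad (Z : Matrix ι τ ℝ) : Matrix ι τ ℝ :=
  of fun i t => (rowNorm Z i)⁻¹ *
    ((rowCorr Z ^ 3 * normRows Z : Matrix ι τ ℝ) i t - (rowCorr Z ^ 4) i i * normRows Z i t)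

lemma normRows_apply (Z : Matrix ι τ ℝ) (i : ι) (t : τ) :
    normRows Z i t = (rowNorm Z i)⁻¹ * Z i t := rfl

lemma corrGrad_apply (Z : Matrix ι τ ℝ) (i : ι) (t : τ) :
    corrGrad Z i t = (rowNorm Z i)⁻¹ * ((rowCorr Z ^ 3 * normRows Z : Matrix ι τ ℝ) i t
      - (rowCorr Z ^ 4) i i * normRows Z i t) := rfl

lemma rowNorm_eq_norm (Z : Matrix ι τ ℝ) (i : ι) :
    rowNorm Z i = ‖(WithLp.toLp 2 (Z i) : EuclideanSpace ℝ τ)‖ := by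
  rw [EuclideanSpace.norm_eq, rowNorm]; simp

lemma rowNorm_nonneg (Z : Matrix ι τ ℝ) (i : ι) : 0 ≤ rowNorm Z i := Real.sqrt_nonneg _

lemma rowNorm_sq (Z : Matrix ι τ ℝ) (i : ι) : rowNorm Z i ^ 2 = ∑ t, Z i t ^ 2 :=
  Real.sq_sqrt (by positivity)

lemma sum_rowNorm_sq (Z : Matrix ι τ ℝ) : ∑ i, rowNorm Z i ^ 2 = frob Z ^ 2 := by
  simp_rw [rowNorm_sq, frob_sq]

lemma rowNorm_le_frob (Z : Matrix ι τ ℝ) (i : ι) : rowNorm Z i ≤ frob Z := by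
  apply le_of_sq_le_sq _ (frob_nonneg _)
  rw [← sum_rowNorm_sq]
  exact Finset.single_le_sum (f := fun i => rowNorm Z i ^ 2) (fun _ _ => sq_nonneg _)
    (Finset.mem_univ i)

lemma abs_sum_row_mul_le (A B : Matrix ι τ ℝ) (i j : ι) :
    |∑ t, A i t * B j t| ≤ rowNorm A i * rowNorm B j := by
  apply abs_le_of_sq_le_sq _ (mul_nonneg (rowNorm_nonneg _ _) (rowNorm_nonneg _ _))
  rw [mul_pow, rowNorm_sq, rowNorm_sq]
  exact Finset.sum_mul_sq_le_sq_mul_sq _ _ _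

lemma rowNorm_normRows_le (Z : Matrix ι τ ℝ) (i : ι) : rowNorm (normRows Z) i ≤ 1 := by
  apply le_of_sq_le_sq _ zero_le_one
  rw [rowNorm_sq]
  simp only [normRows, of_apply, mul_pow, ← Finset.mul_sum, ← rowNorm_sq]
  rw [inv_pow, one_pow]
  exact inv_mul_le_one

lemma rowCorr_transpose (Z : Matrix ι τ ℝ) : (rowCorr Z)ᵀ = rowCorr Z := by simp [rowCorr]

/-- Each row of the gradient is a linear combination of rows of the normalized panel. Row sums zero
are one of the two ingredients of the exchangeability argument. -/
lemma sum_corrGrad (Z : Matrix ι τ ℝ) (h : ∀ i, ∑ t, Z i t = 0) (i : ι) :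
    ∑ t, corrGrad Z i t = 0 := by
  have hM (j : ι) : ∑ t, normRows Z j t = 0 := by simp [normRows, ← Finset.mul_sum, h]
  have hA : ∑ t, (rowCorr Z ^ 3 * normRows Z : Matrix ι τ ℝ) i t = 0 := by
    simp_rw [mul_apply]
    rw [Finset.sum_comm]
    simp_rw [← Finset.mul_sum, hM, mul_zero, Finset.sum_const_zero]
  simp only [corrGrad, of_apply]
  rw [← Finset.mul_sum, Finset.sum_sub_distrib, hA, ← Finset.mul_sum, hM]
  simp

section Perm

lemma rowNorm_submatrix (Z : Matrix ι τ ℝ) (π : Equiv.Perm τ) (i : ι) :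
    rowNorm (Z.submatrix id π) i = rowNorm Z i := by
  simp only [rowNorm, submatrix_apply, id]
  rw [Equiv.sum_comp π fun t => Z i t ^ 2]

lemma normRows_submatrix (Z : Matrix ι τ ℝ) (π : Equiv.Perm τ) :
    normRows (Z.submatrix id π) = (normRows Z).submatrix id π := by
  ext i t
  simp [normRows, rowNorm_submatrix]

lemma submatrix_mul_transpose (Z : Matrix ι τ ℝ) (π : Equiv.Perm τ) :
    Z.submatrix id π * (Z.submatrix id π)ᵀ = Z * Zᵀ := by
  ext i j
  simp only [mul_apply, transpose_apply, submatrix_apply, id]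
  exact Equiv.sum_comp π fun t => Z i t * Z j t

lemma rowCorr_submatrix (Z : Matrix ι τ ℝ) (π : Equiv.Perm τ) :
    rowCorr (Z.submatrix id π) = rowCorr Z := by
  rw [rowCorr, normRows_submatrix, submatrix_mul_transpose, rowCorr]

/-- The other ingredient: the correlation matrix does not see the order of the periods, so the
gradient is equivariant under their permutations. -/
lemma corrGrad_submatrix (Z : Matrix ι τ ℝ) (π : Equiv.Perm τ) :
    corrGrad (Z.submatrix id π) = (corrGrad Z).submatrix id π := by
  ext i t
  simp [corrGrad, rowNorm_submatrix, rowCorr_submatrix, normRows_submatrix, mul_apply]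

end Perm

variable [DecidableEq τ]

lemma rowNorm_mul_le {σ : Type*} [Fintype σ] [DecidableEq σ] (A : Matrix ι τ ℝ) (B : Matrix τ σ ℝ)
    (i : ι) : rowNorm (A * B) i ≤ rowNorm A i * ‖B‖ := by
  apply le_of_sq_le_sq _ (mul_nonneg (rowNorm_nonneg _ _) (norm_nonneg _))
  rw [mul_pow, rowNorm_sq, rowNorm_sq, mul_comm, ← opNorm_transpose B]
  refine le_trans (le_of_eq ?_) (sum_mulVec_sq_le Bᵀ (A i))
  simp [mulVec, dotProduct, mul_apply, mul_comm]

section Bounds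

variable {Z : Matrix ι τ ℝ} {K : ℝ}

/-- Moving the cube to the right, `(M M') ^ 3 M = M (M' M) ^ 3`, leaves a row of `M` in front. This
row has length at most one, so it costs no factor `K`. -/
lemma rowNorm_cube_mul_normRows_le (hK : ‖normRows Z‖ ≤ K) (i : ι) :
    rowNorm (rowCorr Z ^ 3 * normRows Z) i ≤ K ^ 6 := by
  set M := normRows Z
  have hK0 : 0 ≤ K := (norm_nonneg _).trans hK
  have e : rowCorr Z ^ 3 * M = M * (Mᵀ * M) ^ 3 := by
    change (M * Mᵀ) ^ 3 * M = M * (Mᵀ * M) ^ 3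
    simp only [pow_succ, pow_zero, Matrix.one_mul, Matrix.mul_assoc]
  rw [e]
  have h1 : ‖Mᵀ * M‖ ≤ K ^ 2 := by
    refine (l2_opNorm_mul _ _).trans ?_
    rw [opNorm_transpose, sq]
    gcongr
  have h2 := opNorm_pow_le _ h1 3 (by norm_num)
  calc _ ≤ rowNorm M i * ‖(Mᵀ * M) ^ 3‖ := rowNorm_mul_le _ _ _
    _ ≤ 1 * (K ^ 2) ^ 3 := by
        gcongr
        exact rowNorm_normRows_le Z i
    _ = K ^ 6 := by ring

lemma rowCorr_pow_four_apply (i j : ι) :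
    (rowCorr Z ^ 4) i j = ∑ t, (rowCorr Z ^ 3 * normRows Z : Matrix ι τ ℝ) i t * normRows Z j t := by
  rw [pow_succ, rowCorr, ← Matrix.mul_assoc, mul_apply]; rfl

lemma abs_rowCorr_pow_four_apply_le (hK : ‖normRows Z‖ ≤ K) (i : ι) :
    |(rowCorr Z ^ 4) i i| ≤ K ^ 6 := by
  rw [rowCorr_pow_four_apply]
  refine (abs_sum_row_mul_le _ _ i i).trans ?_
  have h1 := rowNorm_cube_mul_normRows_le hK i
  have h2 := rowNorm_normRows_le Z i
  have h3 := rowNorm_nonneg (normRows Z) i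
  have h4 := rowNorm_nonneg (rowCorr Z ^ 3 * normRows Z) i
  nlinarith

lemma opNorm_rowCorr_le (hK : ‖normRows Z‖ ≤ K) : ‖rowCorr Z‖ ≤ K ^ 2 :=
  (opNorm_mul_transpose_self_le _).trans (by gcongr)

lemma opNorm_diagonal_le {v : ι → ℝ} {b : ℝ} (hb : 0 ≤ b) (h : ∀ i, |v i| ≤ b) :
    ‖(diagonal v : Matrix ι ι ℝ)‖ ≤ b := by
  rw [l2_opNorm_diagonal]
  exact (pi_norm_le_iff_of_nonneg hb).2 h

/-- The gradient is a diagonal matrix of inverse row lengths times two terms of spectral norm at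
most `K ^ 7`. -/
lemma opNorm_corrGrad_le {ρ : ℝ} (hρ : 0 < ρ) (hZ : ∀ i, ρ ≤ rowNorm Z i)
    (hK : ‖normRows Z‖ ≤ K) : ‖corrGrad Z‖ ≤ 2 * K ^ 7 / ρ := by
  have hK0 : 0 ≤ K := (norm_nonneg _).trans hK
  have e : corrGrad Z = diagonal (fun i => (rowNorm Z i)⁻¹) *
      (rowCorr Z ^ 3 * normRows Z - diagonal (fun i => (rowCorr Z ^ 4) i i) * normRows Z) := by
    ext i t
    simp [corrGrad, diagonal_mul]
  have h1 : ‖(diagonal fun i => (rowNorm Z i)⁻¹ : Matrix ι ι ℝ)‖ ≤ ρ⁻¹ := by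
    refine opNorm_diagonal_le (by positivity) fun i => ?_
    rw [abs_of_nonneg (inv_nonneg.2 (rowNorm_nonneg _ _))]
    exact inv_anti₀ hρ (hZ i)
  have h2 : ‖(diagonal fun i => (rowCorr Z ^ 4) i i : Matrix ι ι ℝ)‖ ≤ K ^ 6 :=
    opNorm_diagonal_le (by positivity) (abs_rowCorr_pow_four_apply_le hK)
  have h3 : ‖rowCorr Z ^ 3‖ ≤ (K ^ 2) ^ 3 :=
    opNorm_pow_le _ (opNorm_rowCorr_le hK) 3 (by norm_num)
  rw [e]
  calc _ ≤ _ := l2_opNorm_mul _ _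
    _ ≤ ρ⁻¹ * ((K ^ 2) ^ 3 * K + K ^ 6 * K) := by
        refine mul_le_mul h1 ((norm_sub_le _ _).trans (add_le_add ?_ ?_)) (norm_nonneg _)
          (by positivity)
        · exact (l2_opNorm_mul _ _).trans (mul_le_mul h3 hK (norm_nonneg _) (by positivity))
        · exact (l2_opNorm_mul _ _).trans (mul_le_mul h2 hK (norm_nonneg _) (by positivity))
    _ = _ := by field_simp; ring

variable {D : Matrix ι τ ℝ} {ρ : ℝ}

/-- Applied row by row: since `frob D` is at most half the shortest row length, every row of `D` is
short enough for the Lipschitz bound. -/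
lemma frob_normRows_add_sub_le (hρ : 0 < ρ) (hZ : ∀ i, ρ ≤ rowNorm Z i) (hD : 2 * frob D ≤ ρ) :
    frob (normRows (Z + D) - normRows Z) ≤ 2 * (frob D / ρ) := by
  apply le_of_sq_le_sq _ (by have := frob_nonneg D; positivity)
  rw [frob_sq, mul_pow, div_pow, ← sum_rowNorm_sq D, Finset.sum_div, Finset.mul_sum]
  refine Finset.sum_le_sum fun i _ => ?_
  have hr := rowNorm_eq_norm Z i
  have hd := rowNorm_eq_norm D i
  have hs := rowNorm_eq_norm (Z + D) i
  have ha : (WithLp.toLp 2 (Z i) : EuclideanSpace ℝ τ) ≠ 0 := by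
    rw [← norm_pos_iff, ← hr]; linarith [hZ i]
  have hle : rowNorm D i ≤ rowNorm Z i / 2 := by linarith [rowNorm_le_frob D i, hZ i]
  have key := norm_normalize_add_sub_le (d := (WithLp.toLp 2 (D i) : EuclideanSpace ℝ τ)) ha
    (by rw [← hr, ← hd]; exact hle)
  rw [← hr, ← hd] at key
  have key2 := pow_le_pow_left₀ (norm_nonneg _) key 2
  rw [EuclideanSpace.norm_sq_eq] at key2
  have e : (WithLp.toLp 2 (Z i) + WithLp.toLp 2 (D i) : EuclideanSpace ℝ τ)
      = WithLp.toLp 2 ((Z + D) i) := rfl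
  rw [e, ← hs] at key2
  have h3 : ∑ t, (normRows (Z + D) - normRows Z) i t ^ 2 ≤ (2 * (rowNorm D i / rowNorm Z i)) ^ 2 := by
    refine le_trans (le_of_eq (Finset.sum_congr rfl fun t _ => ?_)) key2
    simp [normRows]
  refine h3.trans ?_
  rw [mul_pow, div_pow]
  have := rowNorm_nonneg D i
  have := hZ i
  gcongr

/-- The pairing of `R³ M` with the increment of the normalized rows is given by the gradient up to
a second order error. -/
lemma abs_finner_normRows_sub_le (hρ : 0 < ρ) (hZ : ∀ i, ρ ≤ rowNorm Z i) (hD : 2 * frob D ≤ ρ)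
    (hK : ‖normRows Z‖ ≤ K) :
    |finner (rowCorr Z ^ 3 * normRows Z) (normRows (Z + D) - normRows Z) - finner (corrGrad Z) D|
      ≤ 8 * K ^ 6 * (frob D / ρ) ^ 2 := by
  have hK0 : 0 ≤ K := (norm_nonneg _).trans hK
  rw [finner, finner, ← Finset.sum_sub_distrib, div_pow, ← sum_rowNorm_sq D, Finset.sum_div,
    Finset.mul_sum]
  refine (Finset.abs_sum_le_sum_abs _ _).trans (Finset.sum_le_sum fun i _ => ?_)
  have hr := rowNorm_eq_norm Z i
  have hd := rowNorm_eq_norm D i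
  have hs := rowNorm_eq_norm (Z + D) i
  have hr0 : 0 < rowNorm Z i := by linarith [hZ i]
  have ha : (WithLp.toLp 2 (Z i) : EuclideanSpace ℝ τ) ≠ 0 := by
    rw [← norm_pos_iff, ← hr]; exact hr0
  have hle : rowNorm D i ≤ rowNorm Z i / 2 := by linarith [rowNorm_le_frob D i, hZ i]
  have key := norm_normalize_add_sub_sub_le (d := (WithLp.toLp 2 (D i) : EuclideanSpace ℝ τ)) ha
    (by rw [← hr, ← hd]; exact hle)
  rw [← hr, ← hd] at key
  have e : (WithLp.toLp 2 (Z i) + WithLp.toLp 2 (D i) : EuclideanSpace ℝ τ)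
      = WithLp.toLp 2 ((Z + D) i) := rfl
  have hin : inner ℝ (WithLp.toLp 2 (Z i) : EuclideanSpace ℝ τ) (WithLp.toLp 2 (D i))
      = ∑ t, Z i t * D i t := by
    simp [PiLp.inner_apply, mul_comm]
  rw [e, ← hs, hin] at key
  set s := ∑ t, Z i t * D i t with hs_def
  set rem : Matrix ι τ ℝ := of fun j t => (rowNorm (Z + D) i)⁻¹ * (Z i t + D i t)
    - (rowNorm Z i)⁻¹ * Z i t - ((rowNorm Z i)⁻¹ * D i t - s / rowNorm Z i ^ 3 * Z i t)
  have hrem : rowNorm rem i ≤ 8 * (rowNorm D i / rowNorm Z i) ^ 2 := by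
    rw [rowNorm_eq_norm]
    exact key
  set A := rowCorr Z ^ 3 * normRows Z with hA
  have hAM : ∑ t, A i t * Z i t = rowNorm Z i * (rowCorr Z ^ 4) i i := by
    rw [rowCorr_pow_four_apply, ← hA, Finset.mul_sum]
    refine Finset.sum_congr rfl fun t _ => ?_
    simp only [normRows, of_apply]
    field_simp
  -- The pairing of `A i` with the radial correction equals `s / r ^ 2` times the diagonal entry of
  -- `R ^ 4`, with `r` the length of the row. That is the diagonal term of the gradient paired with
  -- `D`, so only the Taylor remainder is left.
  have split : ∑ t, A i t * (normRows (Z + D) - normRows Z) i t - ∑ t, corrGrad Z i t * D i t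
      = ∑ t, A i t * rem i t := by
    have e1 (t : τ) : A i t * rem i t = A i t * (normRows (Z + D) - normRows Z) i t
        - (rowNorm Z i)⁻¹ * (A i t * D i t) + s / rowNorm Z i ^ 3 * (A i t * Z i t) := by
      simp only [rem, normRows_apply, of_apply, Matrix.sub_apply, Matrix.add_apply]
      ring
    have e2 (t : τ) : corrGrad Z i t * D i t = (rowNorm Z i)⁻¹ * (A i t * D i t)
        - (rowNorm Z i)⁻¹ * (rowCorr Z ^ 4) i i * (rowNorm Z i)⁻¹ * (Z i t * D i t) := by
      rw [corrGrad_apply, ← hA, normRows_apply]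
      ring
    simp_rw [e1, e2, Finset.sum_add_distrib, Finset.sum_sub_distrib, ← Finset.mul_sum, hAM,
      ← hs_def]
    field_simp
    ring
  rw [split]
  refine (abs_sum_row_mul_le A rem i i).trans ?_
  calc rowNorm A i * rowNorm rem i ≤ K ^ 6 * (8 * (rowNorm D i / rowNorm Z i) ^ 2) := by
        gcongr
        · exact rowNorm_nonneg _ _
        · exact rowNorm_cube_mul_normRows_le hK i
    _ ≤ K ^ 6 * (8 * (rowNorm D i / ρ) ^ 2) := by
        have := rowNorm_nonneg D i
        have := hZ i
        gcongr
    _ = 8 * K ^ 6 * (rowNorm D i ^ 2 / ρ ^ 2) := by ring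

/-- First order expansion of `Z ↦ tr (rowCorr Z ^ 4)`. -/
theorem abs_trace_rowCorr_add_sub_le (hρ : 0 < ρ) (hZ : ∀ i, ρ ≤ rowNorm Z i)
    (hD : 2 * frob D ≤ ρ) (hK : ‖normRows Z‖ ≤ K) (hK1 : 1 ≤ K) :
    |(rowCorr (Z + D) ^ 4).trace - (rowCorr Z ^ 4).trace - 8 * finner (corrGrad Z) D|
      ≤ 1100 * K ^ 6 * (frob D / ρ) ^ 2 := by
  have hK0 : 0 ≤ K := (norm_nonneg _).trans hK
  set M := normRows Z with hM
  set E := normRows (Z + D) - M with hE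
  have hMe : normRows (Z + D) = M + E := by rw [hE]; abel
  set x := frob D / ρ with hx
  have hx0 : 0 ≤ x := div_nonneg (frob_nonneg _) hρ.le
  have hx2 : x ≤ 1 / 2 := by rw [hx, div_le_iff₀ hρ]; linarith
  have hEx : frob E ≤ 2 * x := frob_normRows_add_sub_le hρ hZ hD
  set H := M * Eᵀ + E * Mᵀ + E * Eᵀ with hH
  have hR : rowCorr (Z + D) = rowCorr Z + H := by
    rw [rowCorr, hMe, rowCorr, ← hM, hH, transpose_add, Matrix.add_mul, Matrix.mul_add,
      Matrix.mul_add]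
    abel
  have hE0 := frob_nonneg E
  have hME : frob (M * Eᵀ) ≤ K * (2 * x) := by
    refine (frob_mul_le_opNorm_mul _ _).trans ?_
    rw [frob_transpose]
    gcongr
  have hEM : frob (E * Mᵀ) ≤ K * (2 * x) := by
    rwa [← frob_transpose, transpose_mul, transpose_transpose]
  have hEE : frob (E * Eᵀ) ≤ 2 * x * (2 * x) := by
    refine (frob_mul_le_mul_opNorm _ _).trans ?_
    rw [opNorm_transpose]
    gcongr
    exact (opNorm_le_frob E).trans hEx
  have hHx : frob H ≤ 6 * K * x := by
    refine (frob_add_le _ _).trans ((add_le_add (frob_add_le _ _) le_rfl).trans ?_)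
    nlinarith
  have h1 := abs_trace_add_pow_four_sub_le (rowCorr Z) H (opNorm_rowCorr_le hK) hHx
  have h2 := abs_finner_normRows_sub_le hρ hZ hD hK
  rw [← hM, ← hE, ← hx] at h2
  set A := rowCorr Z ^ 3 * M with hA
  -- The two linear parts of `H` contribute equally. Together with the coefficient 4 of `R ^ 3 H`
  -- this is the source of the factor 8.
  have h3 : (rowCorr Z ^ 3 * H).trace = 2 * finner A E + (rowCorr Z ^ 3 * E * Eᵀ).trace := by
    have hs : (rowCorr Z ^ 3)ᵀ = rowCorr Z ^ 3 := by rw [transpose_pow, rowCorr_transpose]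
    have a1 : (rowCorr Z ^ 3 * (M * Eᵀ)).trace = finner A E := by
      rw [finner_eq_trace, hA, Matrix.mul_assoc]
    have a2 : (rowCorr Z ^ 3 * (E * Mᵀ)).trace = finner A E := by
      rw [finner_comm, finner_eq_trace, hA, transpose_mul, hs, trace_mul_comm, Matrix.mul_assoc]
    rw [hH, Matrix.mul_add, Matrix.mul_add, trace_add, trace_add, a1, a2, Matrix.mul_assoc]
    ring
  have h4 : |(rowCorr Z ^ 3 * E * Eᵀ).trace| ≤ (K ^ 2) ^ 3 * (2 * x) * (2 * x) := by
    refine (abs_trace_mul_le _ _).trans ?_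
    rw [frob_transpose]
    have h5 := opNorm_pow_le _ (opNorm_rowCorr_le hK) 3 (by norm_num)
    have h6 : frob (rowCorr Z ^ 3 * E) ≤ (K ^ 2) ^ 3 * (2 * x) :=
      (frob_mul_le_opNorm_mul _ _).trans (by gcongr)
    gcongr
  rw [hR]
  -- The constant is 972 = 216 + 432 + 324. The quadratic part of `H` in the linear trace term adds
  -- 16 and the remainder of the normalization adds 64, which stays below 1100.
  have h7 : 6 * (K ^ 2) ^ 2 * (6 * K * x) ^ 2 + 4 * K ^ 2 * (6 * K * x) ^ 3 + (6 * K * x) ^ 4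
      ≤ 972 * K ^ 6 * x ^ 2 := by
    have e5 : K ^ 5 ≤ K ^ 6 := pow_le_pow_right₀ hK1 (by norm_num)
    have e4 : K ^ 4 ≤ K ^ 6 := pow_le_pow_right₀ hK1 (by norm_num)
    have e3 : x ^ 3 ≤ 1 / 2 * x ^ 2 := by nlinarith [sq_nonneg x]
    have e2 : x ^ 4 ≤ 1 / 4 * x ^ 2 := by nlinarith [sq_nonneg x]
    calc _ = 216 * K ^ 6 * x ^ 2 + 864 * K ^ 5 * x ^ 3 + 1296 * K ^ 4 * x ^ 4 := by ring
      _ ≤ 216 * K ^ 6 * x ^ 2 + 864 * K ^ 6 * (1 / 2 * x ^ 2)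
          + 1296 * K ^ 6 * (1 / 4 * x ^ 2) := by gcongr
      _ = _ := by ring
  rw [abs_le] at *
  have h8 : (K ^ 2) ^ 3 * (2 * x) * (2 * x) = 4 * (K ^ 6 * x ^ 2) := by ring
  have h9 : 0 ≤ K ^ 6 * x ^ 2 := by positivity
  constructor <;> nlinarith

end Bounds

end RowNormalize

/-! ### Panels, and OLS residuals as projected errors -/

/-- The `n × T` panel of the raw series. -/
def panel (n T : ℕ) (e : ℕ → ℕ → ℝ) : Matrix (Fin n) (Fin T) ℝ := of fun i t => e i t

lemma panel_apply (n T : ℕ) (e : ℕ → ℕ → ℝ) (i : Fin n) (t : Fin T) : panel n T e i t = e i t := rfl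

/-- The `n × T` panel of the time-centred series. -/
def centeredPanel (n T : ℕ) (e : ℕ → ℕ → ℝ) : Matrix (Fin n) (Fin T) ℝ :=
  panel n T fun i t => centered T (e i) t

lemma centeredPanel_apply (n T : ℕ) (e : ℕ → ℕ → ℝ) (i : Fin n) (t : Fin T) :
    centeredPanel n T e i t = centered T (e i) t := rfl

/-- The factor `T⁻¹` of the covariance cancels against the two inverse standard deviations. A row of
zeros gives zero on both sides, since the inverse of zero is zero. -/
lemma sampleCorr_eq_rowCorr (n T : ℕ) (e : ℕ → ℕ → ℝ) :
    sampleCorr n T e = rowCorr (panel n T e) := by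
  have hS (i j : Fin n) : sampleCov n T e i j = (T : ℝ)⁻¹ * ∑ t : Fin T, e i t * e j t := by
    rw [sampleCov, Matrix.smul_apply, Matrix.sum_apply, smul_eq_mul]
    simp only [vecMulVec_apply]
    rw [Finset.sum_range fun t => e i t * e j t]
  ext i j
  rw [sampleCorr, diagInvSqrt, mul_diagonal, diagonal_mul, rowCorr, mul_apply]
  simp only [hS, transpose_apply, normRows_apply, rowNorm, panel_apply]
  rcases Nat.eq_zero_or_pos T with rfl | hT
  · simp
  have hT' : (0 : ℝ) < T := by exact_mod_cast hT
  rw [Real.sqrt_mul (by positivity), Real.sqrt_mul (by positivity)]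
  have h1 : √(T : ℝ)⁻¹ * √(T : ℝ)⁻¹ = (T : ℝ)⁻¹ := Real.mul_self_sqrt (by positivity)
  have h2 : (√(T : ℝ)⁻¹)⁻¹ * (√(T : ℝ)⁻¹)⁻¹ * (T : ℝ)⁻¹ = 1 := by
    rw [← mul_inv, h1]
    field_simp
  simp only [← sq, mul_inv]
  have h3 (t : Fin T) : (√(∑ t : Fin T, e i t ^ 2))⁻¹ * e i t * ((√(∑ t : Fin T, e j t ^ 2))⁻¹ * e j t)
      = (√(∑ t : Fin T, e i t ^ 2))⁻¹ * (√(∑ t : Fin T, e j t ^ 2))⁻¹ * (e i t * e j t) := by ring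
  simp_rw [h3, ← Finset.mul_sum]
  linear_combination ((√(∑ t : Fin T, e i t ^ 2))⁻¹ * (√(∑ t : Fin T, e j t ^ 2))⁻¹ *
    ∑ t : Fin T, e i t * e j t) * h2

lemma sum_centered {M : Type*} [AddCommGroup M] [Module ℝ M] (T : ℕ) (z : ℕ → M) :
    ∑ t : Fin T, centered T z t = 0 := by
  rcases Nat.eq_zero_or_pos T with rfl | hT
  · simp
  have hT' : (T : ℝ) ≠ 0 := by exact_mod_cast hT.ne'
  simp only [centered, Finset.sum_sub_distrib, Finset.sum_const, Finset.card_univ,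
    Fintype.card_fin]
  rw [Finset.sum_range, ← Nat.cast_smul_eq_nsmul ℝ, smul_smul, mul_inv_cancel₀ hT', one_smul,
    sub_self]

lemma centered_apply {k : ℕ} (T : ℕ) (z : ℕ → Fin k → ℝ) (t : ℕ) (l : Fin k) :
    centered T z t l = centered T (fun s => z s l) t := by
  simp [centered]

lemma centered_model {k T : ℕ} (hT : 0 < T) (a : ℝ) (β : Fin k → ℝ) (x : ℕ → Fin k → ℝ)
    (η : ℕ → ℝ) (t : ℕ) :
    centered T (fun s => a + x s ⬝ᵥ β + η s) t = centered T x t ⬝ᵥ β + centered T η t := by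
  have hT' : (T : ℝ) ≠ 0 := by exact_mod_cast hT.ne'
  simp only [centered, Finset.sum_add_distrib, Finset.sum_const, Finset.card_range, sub_dotProduct,
    smul_dotProduct, sum_dotProduct, smul_eq_mul, nsmul_eq_mul]
  field_simp
  ring

lemma gram_mulVec {k : ℕ} (n T : ℕ) (x : ℕ → ℕ → Fin k → ℝ) (b : Fin k → ℝ) :
    gram n T x *ᵥ b = ∑ t ∈ Finset.range T, ∑ i ∈ Finset.range n,
      (centered T (x i) t ⬝ᵥ b) • centered T (x i) t := by
  simp only [gram, sum_mulVec, vecMulVec_mulVec]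
  simp [dotProduct_comm]

/-- The OLS residuals depend on the errors only. -/
lemma residual_model {k n T : ℕ} (hT : 0 < T) (a : ℕ → ℝ) (β : Fin k → ℝ)
    (x : ℕ → ℕ → Fin k → ℝ) (η y : ℕ → ℕ → ℝ) (hy : ∀ i t, y i t = a i + x i t ⬝ᵥ β + η i t)
    (hG : IsUnit (gram n T x)) : residual n T y x = residual n T η x := by
  have hy' (i t : ℕ) : centered T (y i) t = centered T (x i) t ⬝ᵥ β + centered T (η i) t := by
    rw [← centered_model hT (a i) β (x i) (η i) t]
    congr 1
    exact funext fun s => hy i s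
  have hβ : olsEstimator n T y x = β + olsEstimator n T η x := by
    have hdet : IsUnit (gram n T x).det := (Matrix.isUnit_iff_isUnit_det _).1 hG
    simp only [olsEstimator, hy', add_smul, Finset.sum_add_distrib]
    rw [← gram_mulVec, mulVec_add, mulVec_mulVec, nonsing_inv_mul _ hdet, one_mulVec]
  ext i t
  rw [residual, residual, hy', hβ, dotProduct_add]
  ring

/-- The panel of the centred `l`-th regressor. -/
def regressorPanel {k : ℕ} (n T : ℕ) (x : ℕ → ℕ → Fin k → ℝ) (l : Fin k) :
    Matrix (Fin n) (Fin T) ℝ := of fun i t => centered T (x i) t l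

lemma gram_apply {k : ℕ} (n T : ℕ) (x : ℕ → ℕ → Fin k → ℝ) (l m : Fin k) :
    gram n T x l m = finner (regressorPanel n T x l) (regressorPanel n T x m) := by
  simp only [gram, Matrix.sum_apply, vecMulVec_apply, finner, regressorPanel, of_apply]
  rw [Finset.sum_comm, Finset.sum_range fun i => ∑ t ∈ Finset.range T, _]
  refine Finset.sum_congr rfl fun i _ => ?_
  rw [Finset.sum_range]

lemma gram_posSemidef {k : ℕ} (n T : ℕ) (x : ℕ → ℕ → Fin k → ℝ) : (gram n T x).PosSemidef := by
  refine posSemidef_sum _ fun t _ => posSemidef_sum _ fun i _ => ?_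
  simpa using posSemidef_vecMulVec_self_star (centered T (x i) t)

/-- The time means are orthogonal to centred rows. The projection coefficients can thus be computed
from the raw errors, which are uncorrelated, unlike the centred ones. -/
lemma finner_centeredPanel {n T : ℕ} (U : Matrix (Fin n) (Fin T) ℝ) (hU : ∀ i, ∑ t, U i t = 0)
    (η : ℕ → ℕ → ℝ) : finner U (centeredPanel n T η) = finner U (panel n T η) := by
  simp only [finner, centeredPanel_apply, panel_apply, centered, mul_sub, Finset.sum_sub_distrib,
    ← Finset.sum_mul, hU]
  simp

lemma finner_sum_smul_left {ι τ κ : Type*} [Fintype ι] [Fintype τ] [Fintype κ] (c : κ → ℝ)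
    (X : κ → Matrix ι τ ℝ) (A : Matrix ι τ ℝ) :
    finner (∑ l, c l • X l) A = ∑ l, c l * finner (X l) A := by
  rw [finner_comm, finner_sum_right]
  simp_rw [finner_smul_right, finner_comm A]

open scoped MatrixOrder Matrix.Norms.L2Operator in
/-- The residuals are the errors minus their projection on the span of the centred regressors. -/
theorem exists_residual_eq_sub_projection {k : ℕ} (n T : ℕ) (x : ℕ → ℕ → Fin k → ℝ)
    (hG : IsUnit (gram n T x)) :
    ∃ U : Fin k → Matrix (Fin n) (Fin T) ℝ, (∀ l, frob (U l) = 1) ∧ (∀ l i, ∑ t, U l i t = 0) ∧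
      ∀ η : ℕ → ℕ → ℝ, panel n T (residual n T η x)
        = centeredPanel n T η + -∑ l, finner (U l) (panel n T η) • U l := by
  have hpd : (gram n T x)⁻¹.PosDef := ((gram_posSemidef n T x).posDef_iff_isUnit.2 hG).inv
  -- A factor `C' C` of the inverse Gram matrix: its rows orthonormalize the regressor panels with
  -- respect to the Frobenius inner product.
  obtain ⟨C, hC⟩ := CStarAlgebra.nonneg_iff_eq_star_mul_self.1 hpd.posSemidef.nonneg
  rw [star_eq_conjTranspose, conjTranspose_eq_transpose_of_trivial] at hC
  have hdet : IsUnit (gram n T x).det := (Matrix.isUnit_iff_isUnit_det _).1 hG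
  have hCG : C * gram n T x * Cᵀ = 1 := by
    rw [mul_eq_one_comm, ← Matrix.mul_assoc, ← hC, nonsing_inv_mul _ hdet]
  set X := regressorPanel n T x with hX
  set U : Fin k → Matrix (Fin n) (Fin T) ℝ := fun m => ∑ l, C m l • X l with hU
  have hX0 (l : Fin k) (i : Fin n) : ∑ t, X l i t = 0 := by
    have := congrFun (sum_centered T (x i)) l
    rwa [Finset.sum_apply] at this
  have hUapp (m : Fin k) (i : Fin n) (t : Fin T) : U m i t = ∑ l, C m l * X l i t := by
    simp [hU, Matrix.sum_apply]
  have hU0 (m : Fin k) (i : Fin n) : ∑ t, U m i t = 0 := by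
    simp_rw [hUapp]
    rw [Finset.sum_comm]
    simp_rw [← Finset.mul_sum, hX0, mul_zero, Finset.sum_const_zero]
  refine ⟨U, fun m => ?_, hU0, fun η => ?_⟩
  · have h1 : finner (U m) (U m) = (C * gram n T x * Cᵀ) m m := by
      rw [hU, finner_sum_smul_left]
      simp_rw [finner_sum_right, finner_smul_right, mul_apply, transpose_apply, gram_apply,
        Finset.sum_mul, Finset.mul_sum]
      rw [Finset.sum_comm]
      refine Finset.sum_congr rfl fun a _ => Finset.sum_congr rfl fun b _ => ?_
      ring
    rw [finner_self, hCG, one_apply_eq] at h1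
    exact (pow_eq_one_iff_of_nonneg (frob_nonneg _) two_ne_zero).1 h1
  · set w : Fin k → ℝ := fun l => finner (X l) (centeredPanel n T η) with hw
    have hw' : ∑ t ∈ Finset.range T, ∑ i ∈ Finset.range n,
        centered T (η i) t • centered T (x i) t = w := by
      ext l
      simp only [Finset.sum_apply, Pi.smul_apply, smul_eq_mul, hw, finner, centeredPanel_apply, hX,
        regressorPanel, of_apply]
      rw [Finset.sum_comm, Finset.sum_range fun i => ∑ t ∈ Finset.range T, _]
      refine Finset.sum_congr rfl fun i _ => ?_
      rw [Finset.sum_range]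
      exact Finset.sum_congr rfl fun t _ => mul_comm _ _
    have hUw (m : Fin k) : finner (U m) (panel n T η) = (C *ᵥ w) m := by
      rw [← finner_centeredPanel _ (hU0 m), hU, finner_sum_smul_left]
      rfl
    ext i t
    simp only [panel_apply, residual, olsEstimator, hw', hC, Matrix.add_apply, Matrix.neg_apply,
      Matrix.sum_apply, Matrix.smul_apply, hUw, centeredPanel_apply, smul_eq_mul, sub_eq_add_neg]
    congr 2
    rw [← mulVec_mulVec, dotProduct_mulVec, vecMul_transpose, dotProduct]
    refine Finset.sum_congr rfl fun m _ => ?_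
    rw [hUapp, mul_comm]
    rfl

/-! ### The error model and its moments -/

/-- Errors independent over time and across units, identically distributed over time, centred, with
second moments in `[v, A]` and fourth moments at most `A`. -/
structure ErrorModel {Ω : Type*} [MeasurableSpace Ω] (P : Measure Ω) (ν : ℕ → ℕ → Ω → ℝ)
    (A v : ℝ) : Prop where
  measurable : ∀ i t, Measurable (ν i t)
  indep_time : iIndepFun (fun (t : ℕ) (ω : Ω) (i : ℕ) => ν i t ω) P
  indep_unit : iIndepFun (fun (i : ℕ) (ω : Ω) (t : ℕ) => ν i t ω) P
  identDistrib : ∀ s t : ℕ, IdentDistrib (fun (ω : Ω) (i : ℕ) => ν i s ω)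
    (fun (ω : Ω) (i : ℕ) => ν i t ω) P P
  mean_zero : ∀ i t, ∫ ω, ν i t ω ∂P = 0
  integrable_pow_four : ∀ i t, Integrable (fun ω => ν i t ω ^ 4) P
  pow_four_le : ∀ i t, ∫ ω, ν i t ω ^ 4 ∂P ≤ A
  sq_le : ∀ i t, ∫ ω, ν i t ω ^ 2 ∂P ≤ A
  le_sq : ∀ i t, v ≤ ∫ ω, ν i t ω ^ 2 ∂P
  bound_pos : 0 < A
  var_pos : 0 < v

/-- The errors observed in a period. -/
@[reducible] def timeSigma {Ω : Type*} (ν : ℕ → ℕ → Ω → ℝ) (t : ℕ) : MeasurableSpace Ω :=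
  MeasurableSpace.comap (fun (ω : Ω) (i : ℕ) => ν i t ω) MeasurableSpace.pi

/-- The errors observed in a set of periods. -/
@[reducible] def timesSigma {Ω : Type*} (ν : ℕ → ℕ → Ω → ℝ) (S : Set ℕ) : MeasurableSpace Ω :=
  ⨆ t ∈ S, timeSigma ν t

lemma measurable_timesSigma {Ω : Type*} {ν : ℕ → ℕ → Ω → ℝ} {S : Set ℕ} {t : ℕ} (ht : t ∈ S)
    (i : ℕ) : Measurable[timesSigma ν S] (ν i t) := by
  have h1 : Measurable[timeSigma ν t] (ν i t) :=
    (measurable_pi_apply i).comp (comap_measurable (fun (ω : Ω) (i : ℕ) => ν i t ω))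
  exact h1.mono (le_iSup₂_of_le t ht le_rfl) le_rfl

namespace ErrorModel

set_option linter.unusedSectionVars false

variable {Ω : Type*} [mΩ : MeasurableSpace Ω] {P : Measure Ω} [IsProbabilityMeasure P]
  {ν : ℕ → ℕ → Ω → ℝ} {A v : ℝ}

lemma timesSigma_le (h : ErrorModel P ν A v) (S : Set ℕ) : timesSigma ν S ≤ mΩ := by
  refine iSup₂_le fun t _ => ?_
  exact (measurable_pi_lambda _ fun i => h.measurable i t).comap_le

/-- Separates the present period from any function of the past. -/
lemma indepFun_of_disjoint (h : ErrorModel P ν A v) {S S' : Set ℕ} (hS : Disjoint S S')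
    {α β : Type*} [MeasurableSpace α] [MeasurableSpace β] {X : Ω → α} {Y : Ω → β}
    (hX : Measurable[timesSigma ν S] X) (hY : Measurable[timesSigma ν S'] Y) :
    IndepFun X Y P := by
  have h1 : Indep (timesSigma ν S) (timesSigma ν S') P :=
    indep_iSup_of_disjoint
      (fun t => (measurable_pi_lambda _ fun i => h.measurable i t).comap_le)
      ((iIndepFun_iff_iIndep _ _ _).1 h.indep_time) hS
  rw [IndepFun_iff_Indep]
  exact indep_of_indep_of_le_right (indep_of_indep_of_le_left h1 hX.comap_le) hY.comap_le

lemma integrable_sq (h : ErrorModel P ν A v) (i t : ℕ) :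
    Integrable (fun ω => ν i t ω ^ 2) P := by
  refine Integrable.mono' ((integrable_const (1 : ℝ)).add (h.integrable_pow_four i t))
    ((h.measurable i t).pow_const 2).aestronglyMeasurable (ae_of_all _ fun ω => ?_)
  rw [Real.norm_eq_abs, abs_of_nonneg (sq_nonneg _)]
  simp only [Pi.add_apply]
  nlinarith [sq_nonneg (ν i t ω ^ 2 - 1), sq_nonneg (ν i t ω ^ 2)]

lemma memLp_two (h : ErrorModel P ν A v) (i t : ℕ) : MemLp (ν i t) 2 P :=
  (memLp_two_iff_integrable_sq (h.measurable i t).aestronglyMeasurable).2 (h.integrable_sq i t)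

lemma memLp_two_sq (h : ErrorModel P ν A v) (i t : ℕ) : MemLp (fun ω => ν i t ω ^ 2) 2 P := by
  refine (memLp_two_iff_integrable_sq
    ((h.measurable i t).pow_const 2).aestronglyMeasurable).2 ?_
  simpa [← pow_mul] using h.integrable_pow_four i t

lemma integrable_mul (h : ErrorModel P ν A v) (i t j s : ℕ) :
    Integrable (fun ω => ν i t ω * ν j s ω) P :=
  (h.memLp_two i t).integrable_mul (h.memLp_two j s)

lemma indepFun_time (h : ErrorModel P ν A v) (i j : ℕ) {t s : ℕ} (hts : t ≠ s) :
    IndepFun (ν i t) (ν j s) P :=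
  (h.indep_time.indepFun hts).comp (measurable_pi_apply i) (measurable_pi_apply j)

lemma indepFun_unit (h : ErrorModel P ν A v) {i j : ℕ} (t s : ℕ) (hij : i ≠ j) :
    IndepFun (ν i t) (ν j s) P :=
  (h.indep_unit.indepFun hij).comp (measurable_pi_apply t) (measurable_pi_apply s)

lemma integral_mul_eq_zero (h : ErrorModel P ν A v) {i t j s : ℕ} (hne : (i, t) ≠ (j, s)) :
    ∫ ω, ν i t ω * ν j s ω ∂P = 0 := by
  have hi : IndepFun (ν i t) (ν j s) P := by
    by_cases hij : i = j
    · refine h.indepFun_time i j fun hts => hne (by rw [hij, hts])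
    · exact h.indepFun_unit t s hij
  rw [hi.integral_fun_mul_eq_mul_integral (h.measurable i t).aestronglyMeasurable
    (h.measurable j s).aestronglyMeasurable, h.mean_zero, zero_mul]

/-- Distinct errors are uncorrelated, so only the diagonal of the double sum survives. With `frob U
= 1` this makes the projection coefficients bounded in probability. -/
lemma integral_finner_sq_le (h : ErrorModel P ν A v) {n T : ℕ} (U : Matrix (Fin n) (Fin T) ℝ) :
    Integrable (fun ω => finner U (panel n T fun i t => ν i t ω) ^ 2) P ∧
      ∫ ω, finner U (panel n T fun i t => ν i t ω) ^ 2 ∂P ≤ A * frob U ^ 2 := by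
  have e (ω : Ω) : finner U (panel n T fun i t => ν i t ω) ^ 2
      = ∑ p : Fin n × Fin T, ∑ q : Fin n × Fin T,
        U p.1 p.2 * U q.1 q.2 * (ν p.1 p.2 ω * ν q.1 q.2 ω) := by
    rw [sq, finner, ← Fintype.sum_prod_type', Finset.sum_mul_sum]
    refine Finset.sum_congr rfl fun p _ => Finset.sum_congr rfl fun q _ => ?_
    simp only [panel_apply]
    ring
  have hint (p q : Fin n × Fin T) :
      Integrable (fun ω => U p.1 p.2 * U q.1 q.2 * (ν p.1 p.2 ω * ν q.1 q.2 ω)) P :=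
    (h.integrable_mul _ _ _ _).const_mul _
  simp_rw [e]
  refine ⟨integrable_finsetSum _ fun p _ => integrable_finsetSum _ fun q _ => hint p q, ?_⟩
  rw [integral_finsetSum _ fun p _ => integrable_finsetSum _ fun q _ => hint p q, frob_sq,
    ← Fintype.sum_prod_type', Finset.mul_sum]
  refine Finset.sum_le_sum fun p _ => ?_
  rw [integral_finsetSum _ fun q _ => hint p q, Finset.sum_eq_single p]
  · rw [integral_const_mul]
    have := h.sq_le p.1 p.2
    simp_rw [← sq]
    nlinarith [sq_nonneg (U p.1 p.2)]
  · intro q _ hqp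
    rw [integral_const_mul, h.integral_mul_eq_zero, mul_zero]
    intro hpq
    apply hqp
    rw [Prod.mk.injEq] at hpq
    exact Prod.ext (Fin.ext hpq.1.symm) (Fin.ext hpq.2.symm)
  · simp

lemma _root_.Panel.measureReal_le_of_integral_sq_le {X : Ω → ℝ} {B b : ℝ} (hb : 0 < b)
    (hX : Integrable (fun ω => X ω ^ 2) P) (hB : ∫ ω, X ω ^ 2 ∂P ≤ B) :
    P.real {ω | b ≤ |X ω|} ≤ B / b ^ 2 := by
  have h1 := mul_meas_ge_le_integral_of_nonneg (ae_of_all P fun ω => sq_nonneg (X ω)) hX (b ^ 2)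
  have h2 : {ω | b ≤ |X ω|} = {ω | b ^ 2 ≤ X ω ^ 2} := by
    ext ω
    simp only [Set.mem_ofPred_eq]
    rw [sq_le_sq, abs_of_pos hb]
  rw [h2, le_div_iff₀ (by positivity), mul_comm]
  exact h1.trans hB

/-- Chebyshev's bound for the length of the error vector of one period. -/
lemma measureReal_sum_sq_gt_le (h : ErrorModel P ν A v) {n T : ℕ} {C a : ℝ} (hT : 0 < T)
    (hn : (n : ℝ) ≤ C * T) (ha : 0 < a) (haC : 2 * A * C ≤ a) (t : ℕ) :
    P.real {ω | a * T < ∑ i ∈ Finset.range n, ν i t ω ^ 2} ≤ 4 * A * C / (a ^ 2 * T) := by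
  have hT' : (0 : ℝ) < T := by exact_mod_cast hT
  set X : Ω → ℝ := ∑ i ∈ Finset.range n, fun ω => ν i t ω ^ 2 with hX
  have hXapp (ω : Ω) : X ω = ∑ i ∈ Finset.range n, ν i t ω ^ 2 := by rw [hX, Finset.sum_apply]
  have hmem : MemLp X 2 P := memLp_finsetSum' _ fun i _ => h.memLp_two_sq i t
  have hE : ∫ ω, X ω ∂P ≤ A * C * T := by
    simp_rw [hXapp]
    rw [integral_finsetSum _ fun i _ => h.integrable_sq i t]
    refine (Finset.sum_le_sum fun i _ => h.sq_le i t).trans ?_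
    rw [Finset.sum_const, Finset.card_range, nsmul_eq_mul]
    nlinarith [h.bound_pos]
  have hV : variance X P ≤ A * C * T := by
    rw [hX, IndepFun.variance_sum (fun i _ => h.memLp_two_sq i t)]
    · refine (Finset.sum_le_sum (g := fun _ => A) fun i _ => ?_).trans ?_
      · refine (variance_le_expectation_sq
          ((h.measurable i t).pow_const 2).aestronglyMeasurable).trans ?_
        simpa [← pow_mul] using h.pow_four_le i t
      · rw [Finset.sum_const, Finset.card_range, nsmul_eq_mul]
        nlinarith [h.bound_pos]
    · intro i _ j _ hij
      exact (h.indepFun_unit t t hij).comp (measurable_id.pow_const 2) (measurable_id.pow_const 2)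
  have hc : 0 < a * T / 2 := by positivity
  have hch := meas_ge_le_variance_div_sq hmem hc
  -- The mean is at most `A C T`, hence at most half of the level `a T`; the excess is a deviation
  -- of at least `a T / 2`.
  have hsub : {ω | a * T < ∑ i ∈ Finset.range n, ν i t ω ^ 2}
      ⊆ {ω | a * T / 2 ≤ |X ω - ∫ ω, X ω ∂P|} := by
    intro ω hω
    simp only [Set.mem_ofPred_eq] at hω ⊢
    rw [← hXapp] at hω
    refine le_trans ?_ (le_abs_self _)
    nlinarith
  refine (measureReal_mono hsub).trans ?_
  rw [measureReal_def]
  refine (ENNReal.toReal_mono ENNReal.ofReal_ne_top hch).trans ?_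
  rw [ENNReal.toReal_ofReal (div_nonneg (variance_nonneg _ _) (sq_nonneg _))]
  calc variance X P / (a * T / 2) ^ 2 ≤ A * C * T / (a * T / 2) ^ 2 := by gcongr
    _ = _ := by field_simp; ring

/-! ### Lower bound for the lengths of the centred rows -/

section RowNorms

lemma _root_.Panel.exp_neg_le {x : ℝ} (hx : 0 ≤ x) : Real.exp (-x) ≤ 1 - x + x ^ 2 / 2 := by
  have h1 := Real.quadratic_le_exp_of_nonneg hx
  rw [Real.exp_neg, inv_le_iff_one_le_mul₀ (Real.exp_pos x)]
  have h2 : 0 < 1 - x + x ^ 2 / 2 := by nlinarith [sq_nonneg (x - 1)]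
  nlinarith [sq_nonneg (x ^ 2)]

/-- The sum of the squared halved increments over disjoint pairs of consecutive periods. -/
def _root_.Panel.pairSum (z : ℕ → ℝ) (m : ℕ) : ℝ :=
  ∑ j ∈ Finset.range m, (z (2 * j) - z (2 * j + 1)) ^ 2 / 2

/-- For each pair, `(z - w) ^ 2 / 2 ≤ (z - c) ^ 2 + (w - c) ^ 2`. Differences eliminate the unknown
mean and turn the row length into a sum of independent terms. -/
lemma _root_.Panel.pairSum_le_sum_sq (z : ℕ → ℝ) (c : ℝ) (m : ℕ) :
    pairSum z m ≤ ∑ t ∈ Finset.range (2 * m), (z t - c) ^ 2 := by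
  induction m with
  | zero => simp [pairSum]
  | succ m ih =>
    rw [pairSum, Finset.sum_range_succ, ← pairSum, Nat.mul_succ, Finset.sum_range_succ,
      Finset.sum_range_succ]
    nlinarith [sq_nonneg (z (2 * m) - c + (z (2 * m + 1) - c))]

/-- The choice of `c` is the time mean; for odd `T` the last period is dropped. -/
lemma _root_.Panel.pairSum_le_rowNorm_sq (n T : ℕ) (η : ℕ → ℕ → ℝ) (i : Fin n) :
    pairSum (η i) (T / 2) ≤ rowNorm (centeredPanel n T η) i ^ 2 := by
  rw [rowNorm_sq]
  simp only [centeredPanel_apply, centered]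
  rw [← Finset.sum_range fun t => (η i t - (T : ℝ)⁻¹ • ∑ s ∈ Finset.range T, η i s) ^ 2]
  refine (pairSum_le_sum_sq _ _ _).trans (Finset.sum_le_sum_of_subset_of_nonneg ?_ ?_)
  · rw [Finset.range_subset_range]; omega
  · intros; positivity

/-- The halved squared increment has mean at least `v` and second moment at most `4 A`, so `exp (-x)
≤ 1 - x + x ^ 2 / 2` gives the bound `1 - l v + 2 A l ^ 2`. The rate `l = v / (4 A)` minimizes it.
Being a lower-tail estimate, it needs no exponential moments. -/
lemma integral_exp_neg_increment_le (h : ErrorModel P ν A v) (i : ℕ) {s t : ℕ} (hst : s ≠ t) :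
    ∫ ω, Real.exp (-(v / (4 * A)) * ((ν i s ω - ν i t ω) ^ 2 / 2)) ∂P
      ≤ Real.exp (-(v ^ 2 / (8 * A))) := by
  have hA := h.bound_pos
  have hv := h.var_pos
  set l := v / (4 * A) with hl
  have hl0 : 0 < l := by positivity
  have hi2 : Integrable (fun ω => (ν i s ω - ν i t ω) ^ 2 / 2) P := by
    have := ((h.memLp_two i s).sub (h.memLp_two i t)).integrable_sq.div_const 2
    exact this
  have hi4 : Integrable (fun ω => 4 * (ν i s ω ^ 4 + ν i t ω ^ 4)) P :=
    ((h.integrable_pow_four i s).add (h.integrable_pow_four i t)).const_mul _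
  have hE2 : v ≤ ∫ ω, (ν i s ω - ν i t ω) ^ 2 / 2 ∂P := by
    have e (ω : Ω) : (ν i s ω - ν i t ω) ^ 2 / 2
        = (ν i s ω ^ 2 + ν i t ω ^ 2) / 2 - ν i s ω * ν i t ω := by ring
    have hs : Integrable (fun ω => (ν i s ω ^ 2 + ν i t ω ^ 2) / 2) P :=
      ((h.integrable_sq i s).add (h.integrable_sq i t)).div_const 2
    simp_rw [e]
    rw [integral_sub hs (h.integrable_mul _ _ _ _), h.integral_mul_eq_zero (by simpa using hst),
      integral_div, integral_add (h.integrable_sq i s) (h.integrable_sq i t)]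
    linarith [h.le_sq i s, h.le_sq i t]
  have hE4 : ∫ ω, 4 * (ν i s ω ^ 4 + ν i t ω ^ 4) ∂P ≤ 8 * A := by
    rw [integral_const_mul, integral_add (h.integrable_pow_four i s) (h.integrable_pow_four i t)]
    linarith [h.pow_four_le i s, h.pow_four_le i t]
  have hpt (ω : Ω) : Real.exp (-l * ((ν i s ω - ν i t ω) ^ 2 / 2))
      ≤ 1 - l * ((ν i s ω - ν i t ω) ^ 2 / 2)
        + l ^ 2 / 4 * (4 * (ν i s ω ^ 4 + ν i t ω ^ 4)) := by
    have h1 := exp_neg_le (x := l * ((ν i s ω - ν i t ω) ^ 2 / 2)) (by positivity)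
    rw [neg_mul]
    refine h1.trans ?_
    have h2 : (ν i s ω - ν i t ω) ^ 4 ≤ 8 * (ν i s ω ^ 4 + ν i t ω ^ 4) := by
      nlinarith [sq_nonneg (ν i s ω + ν i t ω), sq_nonneg (ν i s ω - ν i t ω),
        sq_nonneg (ν i s ω ^ 2 - ν i t ω ^ 2),
        mul_nonneg (sq_nonneg (ν i s ω + ν i t ω)) (sq_nonneg (ν i s ω - ν i t ω)),
        sq_nonneg ((ν i s ω + ν i t ω) ^ 2)]
    have h3 := mul_le_mul_of_nonneg_left h2 (by positivity : 0 ≤ l ^ 2 / 8)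
    nlinarith
  have hi1 : Integrable (fun ω => 1 - l * ((ν i s ω - ν i t ω) ^ 2 / 2)) P :=
    (integrable_const (1 : ℝ)).sub (hi2.const_mul l)
  have hi3 : Integrable (fun ω => 1 - l * ((ν i s ω - ν i t ω) ^ 2 / 2)
      + l ^ 2 / 4 * (4 * (ν i s ω ^ 4 + ν i t ω ^ 4))) P := hi1.add (hi4.const_mul (l ^ 2 / 4))
  refine (integral_mono_of_nonneg (μ := P)
    (ae_of_all _ fun ω => (Real.exp_pos (-l * ((ν i s ω - ν i t ω) ^ 2 / 2))).le)
    hi3 (ae_of_all _ hpt)).trans ?_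
  rw [integral_add hi1 (hi4.const_mul (l ^ 2 / 4)),
    integral_sub (integrable_const (1 : ℝ)) (hi2.const_mul l), integral_const_mul,
    integral_const_mul]
  simp only [integral_const, probReal_univ, smul_eq_mul, one_mul]
  have h4 : 1 - l * v + l ^ 2 / 4 * (8 * A) = -(v ^ 2 / (8 * A)) + 1 := by
    rw [hl]; field_simp; ring
  have h5 := Real.add_one_le_exp (-(v ^ 2 / (8 * A)))
  have h6 := mul_le_mul_of_nonneg_left hE2 hl0.le
  have h7 := mul_le_mul_of_nonneg_left hE4 (by positivity : 0 ≤ l ^ 2 / 4)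
  linarith

/-- Disjoint pairs of periods are independent, so the expectation of the product factors. -/
lemma integral_exp_neg_pairSum_le (h : ErrorModel P ν A v) (i m : ℕ) :
    ∫ ω, Real.exp (-(v / (4 * A)) * pairSum (fun t => ν i t ω) m) ∂P
      ≤ Real.exp (-(v ^ 2 / (8 * A)) * m) := by
  induction m with
  | zero => simp [pairSum]
  | succ m ih =>
    have e (ω : Ω) : Real.exp (-(v / (4 * A)) * pairSum (fun t => ν i t ω) (m + 1))
        = Real.exp (-(v / (4 * A)) * pairSum (fun t => ν i t ω) m)
          * Real.exp (-(v / (4 * A)) * ((ν i (2 * m) ω - ν i (2 * m + 1) ω) ^ 2 / 2)) := by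
      rw [← Real.exp_add, ← mul_add, pairSum, pairSum, Finset.sum_range_succ]
    have hX : Measurable[timesSigma ν (Set.Iio (2 * m))]
        fun ω => Real.exp (-(v / (4 * A)) * pairSum (fun t => ν i t ω) m) := by
      refine Real.measurable_exp.comp (Measurable.const_mul ?_ _)
      refine Finset.measurable_sum _ fun j hj => ?_
      rw [Finset.mem_range] at hj
      exact (((measurable_timesSigma (Set.mem_Iio.2 (by omega)) i).sub
        (measurable_timesSigma (Set.mem_Iio.2 (by omega)) i)).pow_const 2).div_const 2
    have hY : Measurable[timesSigma ν (Set.Ici (2 * m))] fun ω =>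
        Real.exp (-(v / (4 * A)) * ((ν i (2 * m) ω - ν i (2 * m + 1) ω) ^ 2 / 2)) := by
      refine Real.measurable_exp.comp (Measurable.const_mul ?_ _)
      exact (((measurable_timesSigma (Set.mem_Ici.2 (by omega)) i).sub
        (measurable_timesSigma (Set.mem_Ici.2 (by omega)) i)).pow_const 2).div_const 2
    have hind := h.indepFun_of_disjoint
      (Set.disjoint_left.2 fun a ha hb => absurd (Set.mem_Ici.1 hb) (not_le.2 ha)) hX hY
    simp_rw [e]
    rw [hind.integral_fun_mul_eq_mul_integral
      (hX.mono (h.timesSigma_le _) le_rfl).aestronglyMeasurable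
      (hY.mono (h.timesSigma_le _) le_rfl).aestronglyMeasurable]
    calc _ ≤ Real.exp (-(v ^ 2 / (8 * A)) * m) * Real.exp (-(v ^ 2 / (8 * A))) :=
          mul_le_mul ih (h.integral_exp_neg_increment_le i (by omega))
            (integral_nonneg fun _ => (Real.exp_pos _).le) (Real.exp_pos _).le
      _ = _ := by
          rw [← Real.exp_add]
          push_cast
          ring_nf

/-- Chernoff's bound at rate `v / (4 A)`: the level `v m / 4` costs `v ^ 2 m / (16 A)`, half of the
gain `v ^ 2 m / (8 A)`. -/
lemma measureReal_pairSum_le (h : ErrorModel P ν A v) (i m : ℕ) :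
    P.real {ω | pairSum (fun t => ν i t ω) m ≤ v * m / 4}
      ≤ Real.exp (-(v ^ 2 / (16 * A)) * m) := by
  have hA := h.bound_pos
  have hv := h.var_pos
  have hmeas : Measurable fun ω => pairSum (fun t => ν i t ω) m :=
    Finset.measurable_sum _ fun j _ =>
      (((h.measurable i _).sub (h.measurable i _)).pow_const 2).div_const 2
  have hl : -(v / (4 * A)) ≤ 0 := by
    rw [neg_nonpos]; positivity
  have hps (ω : Ω) : 0 ≤ pairSum (fun t => ν i t ω) m :=
    Finset.sum_nonneg fun _ _ => by positivity
  have hint : Integrable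
      (fun ω => Real.exp (-(v / (4 * A)) * pairSum (fun t => ν i t ω) m)) P := by
    refine Integrable.mono' (integrable_const (1 : ℝ))
      (Real.measurable_exp.comp (hmeas.const_mul _)).aestronglyMeasurable
      (ae_of_all _ fun ω => ?_)
    rw [Real.norm_eq_abs, Real.abs_exp, Real.exp_le_one_iff]
    exact mul_nonpos_of_nonpos_of_nonneg hl (hps ω)
  refine (measure_le_le_exp_mul_mgf (v * m / 4) hl hint).trans ?_
  calc _ ≤ Real.exp (-(-(v / (4 * A))) * (v * m / 4)) * Real.exp (-(v ^ 2 / (8 * A)) * m) := by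
        gcongr
        exact h.integral_exp_neg_pairSum_le i m
    _ = _ := by
        rw [← Real.exp_add]
        congr 1
        field_simp
        ring

/-- The centred error series of all units have length at least of the order `√T`. -/
theorem measureReal_exists_rowNorm_lt_le (h : ErrorModel P ν A v) (n : ℕ) {T : ℕ} (hT : 2 ≤ T) :
    P.real {ω | ∃ i, rowNorm (centeredPanel n T fun i t => ν i t ω) i ^ 2 < v / 16 * T}
      ≤ n * Real.exp (-(v ^ 2 / (64 * A)) * T) := by
  have hA := h.bound_pos
  have hv := h.var_pos
  -- Rounding down the number of pairs costs a factor two, which accounts for `v / 16` in place of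
  -- `v / 8`.
  have hm : (T : ℝ) / 4 ≤ ((T / 2 : ℕ) : ℝ) := by
    have : T ≤ 4 * (T / 2) := by omega
    have : (T : ℝ) ≤ 4 * ((T / 2 : ℕ) : ℝ) := by exact_mod_cast this
    linarith
  have hsub : {ω | ∃ i, rowNorm (centeredPanel n T fun i t => ν i t ω) i ^ 2 < v / 16 * T}
      ⊆ ⋃ i ∈ Finset.range n,
        {ω | pairSum (fun t => ν i t ω) (T / 2) ≤ v * ((T / 2 : ℕ) : ℝ) / 4} := by
    rintro ω ⟨i, hi⟩
    simp only [Set.mem_iUnion, Finset.mem_range]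
    refine ⟨i, i.2, ?_⟩
    have := pairSum_le_rowNorm_sq n T (fun i t => ν i t ω) i
    simp only [Set.mem_ofPred_eq]
    nlinarith
  refine (measureReal_mono hsub (measure_ne_top _ _)).trans
    ((measureReal_biUnion_finset_le _ _).trans ?_)
  refine (Finset.sum_le_sum fun i _ => h.measureReal_pairSum_le i (T / 2)).trans ?_
  rw [Finset.sum_const, Finset.card_range, nsmul_eq_mul]
  refine mul_le_mul_of_nonneg_left (Real.exp_le_exp.2 ?_) (Nat.cast_nonneg n)
  calc -(v ^ 2 / (16 * A)) * ((T / 2 : ℕ) : ℝ) ≤ -(v ^ 2 / (16 * A)) * (T / 4) := by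
        rw [neg_mul, neg_mul, neg_le_neg_iff]
        gcongr
    _ = _ := by field_simp; ring

end RowNorms

end ErrorModel

/-! ### Rank one updates of positive semidefinite matrices -/

section RankOne

set_option linter.unusedSectionVars false

variable {ι : Type*} [Fintype ι] [DecidableEq ι]

/-- Expanding one factor `S + L` at a time leaves sums of nonnegative multiples of powers of `S`. -/
lemma posSemidef_add_smul_one_pow_mul {S : Matrix ι ι ℝ} (hS : S.PosSemidef) {L : ℝ} (hL : 0 ≤ L)
    (j m : ℕ) : ((S + L • 1) ^ j * S ^ m).PosSemidef := by
  induction j generalizing m with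
  | zero => simpa using hS.pow m
  | succ j ih =>
    have e : (S + L • 1) ^ (j + 1) * S ^ m
        = (S + L • 1) ^ j * S ^ (m + 1) + L • ((S + L • 1) ^ j * S ^ m) := by
      rw [pow_succ, pow_succ' S m, Matrix.mul_assoc, Matrix.add_mul, Matrix.mul_add, smul_mul,
        Matrix.one_mul, Matrix.mul_smul]
    rw [e]
    exact (ih (m + 1)).add ((ih m).smul hL)

lemma trace_pow_add_le {S : Matrix ι ι ℝ} (hS : S.PosSemidef) {L : ℝ} (hL : 0 ≤ L) (j m : ℕ) :
    (S ^ (m + j)).trace ≤ ((S + L • 1) ^ j * S ^ m).trace := by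
  induction j generalizing m with
  | zero => simp
  | succ j ih =>
    have e : (S + L • 1) ^ (j + 1) * S ^ m
        = (S + L • 1) ^ j * S ^ (m + 1) + L • ((S + L • 1) ^ j * S ^ m) := by
      rw [pow_succ, pow_succ' S m, Matrix.mul_assoc, Matrix.add_mul, Matrix.mul_add, smul_mul,
        Matrix.one_mul, Matrix.mul_smul]
    rw [e, trace_add, trace_smul, smul_eq_mul]
    have h1 := ih (m + 1)
    have h2 := mul_nonneg hL (posSemidef_add_smul_one_pow_mul hS hL j m).trace_nonneg
    rw [show m + (j + 1) = m + 1 + j by omega]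
    linarith

lemma trace_mul_vecMulVec (A : Matrix ι ι ℝ) (w : ι → ℝ) :
    (A * vecMulVec w w).trace = w ⬝ᵥ A *ᵥ w := by
  rw [mul_vecMulVec, trace_vecMulVec, dotProduct_comm]

lemma vecMulVec_mul_mul_vecMulVec (A : Matrix ι ι ℝ) (w : ι → ℝ) :
    vecMulVec w w * A * vecMulVec w w = (w ⬝ᵥ A *ᵥ w) • vecMulVec w w := by
  rw [Matrix.mul_assoc, mul_vecMulVec, vecMulVec_mul_vecMulVec]
  simp [vecMulVec_smul]

/-- The growth of `tr Y ^ 4` under a rank one update. -/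
lemma trace_add_vecMulVec_pow_four_le {S : Matrix ι ι ℝ} (hS : S.PosSemidef) {L : ℝ} (hL : 0 ≤ L)
    {w : ι → ℝ} (hw : w ⬝ᵥ w ≤ L) :
    ((S + L • 1 + vecMulVec w w) ^ 4).trace
      ≤ ((S + L • 1) ^ 4).trace + 15 * (w ⬝ᵥ (S + L • 1) ^ 3 *ᵥ w) := by
  -- The shift makes `Y ≥ L`, so every power of `Y` gains a factor `L`. Because `w'w ≤ L`, each
  -- repeated `ww'` can be traded for a power of `Y`, until only `w' Y ^ 3 w` remains.
  have hstep (j : ℕ) : L * (w ⬝ᵥ (S + L • 1) ^ j *ᵥ w) ≤ w ⬝ᵥ (S + L • 1) ^ (j + 1) *ᵥ w := by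
    have e : (S + L • 1) ^ (j + 1) = (S + L • 1) ^ j * S ^ 1 + L • (S + L • 1) ^ j := by
      rw [pow_succ, Matrix.mul_add, Matrix.mul_smul, Matrix.mul_one, pow_one]
    have h1 := (posSemidef_add_smul_one_pow_mul hS hL j 1).dotProduct_mulVec_nonneg w
    rw [star_trivial] at h1
    rw [e, add_mulVec, dotProduct_add, smul_mulVec, dotProduct_smul, smul_eq_mul]
    linarith
  have hpos (j : ℕ) : 0 ≤ w ⬝ᵥ (S + L • 1) ^ j *ᵥ w := by
    have h1 := (posSemidef_add_smul_one_pow_mul hS hL j 0).dotProduct_mulVec_nonneg w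
    rwa [star_trivial, pow_zero, Matrix.mul_one] at h1
  set Y := S + L • 1 with hY
  have hYs : Yᵀ = Y := by
    have := hS.isHermitian
    rw [IsHermitian, conjTranspose_eq_transpose_of_trivial] at this
    rw [hY, transpose_add, this, transpose_smul, transpose_one]
  set y : ℕ → ℝ := fun j => w ⬝ᵥ Y ^ j *ᵥ w with hy
  have y0 : w ⬝ᵥ w = y 0 := by simp [hy]
  -- Cauchy-Schwarz for `w` and `Y w`, needed for the alternating word `Y V Y V` with `V = ww'`.
  have hcs : y 1 ^ 2 ≤ y 0 * y 2 := by
    have h2 : y 2 = (Y *ᵥ w) ⬝ᵥ (Y *ᵥ w) := by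
      simp only [hy]
      rw [sq, ← mulVec_mulVec, dotProduct_mulVec, ← mulVec_transpose, hYs]
    rw [h2, ← y0]
    simp only [hy, pow_one, dotProduct]
    simpa [sq] using Finset.sum_mul_sq_le_sq_mul_sq Finset.univ w (Y *ᵥ w)
  have t1 : (Y ^ 3 * vecMulVec w w).trace = y 3 := trace_mul_vecMulVec _ _
  have hVV : vecMulVec w w * vecMulVec w w = y 0 • vecMulVec w w := by
    have := vecMulVec_mul_mul_vecMulVec 1 w
    rwa [Matrix.mul_one, one_mulVec, y0] at this
  have hVYV : vecMulVec w w * Y * vecMulVec w w = y 1 • vecMulVec w w := by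
    rw [vecMulVec_mul_mul_vecMulVec]
    simp [hy]
  have t2 : (Y ^ 2 * vecMulVec w w * vecMulVec w w).trace = y 0 * y 2 := by
    rw [Matrix.mul_assoc, hVV, Matrix.mul_smul, trace_smul, trace_mul_vecMulVec, smul_eq_mul]
  have t3 : (Y * vecMulVec w w * Y * vecMulVec w w).trace = y 1 * y 1 := by
    rw [Matrix.mul_assoc, Matrix.mul_assoc, ← Matrix.mul_assoc (vecMulVec w w), hVYV,
      Matrix.mul_smul, trace_smul, trace_mul_vecMulVec, smul_eq_mul]
    simp [hy]
  have t4 : (Y * vecMulVec w w * vecMulVec w w * vecMulVec w w).trace = y 0 * (y 0 * y 1) := by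
    rw [Matrix.mul_assoc Y, hVV, Matrix.mul_smul, Matrix.smul_mul, Matrix.mul_assoc, hVV,
      Matrix.mul_smul, trace_smul, trace_smul, trace_mul_vecMulVec, smul_eq_mul, smul_eq_mul]
    simp [hy]
  have t5 : (vecMulVec w w ^ 4).trace = y 0 ^ 4 := by
    have : vecMulVec w w ^ 4 = vecMulVec w w * vecMulVec w w * (vecMulVec w w * vecMulVec w w) := by
      rw [← sq, ← sq, ← pow_mul]
    rw [this, hVV, Matrix.smul_mul, Matrix.mul_smul, hVV, trace_smul, trace_smul, trace_smul,
      trace_vecMulVec, y0]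
    simp only [smul_eq_mul]
    ring
  rw [trace_add_pow_four, t1, t2, t3, t4, t5]
  rw [y0] at hw
  have p0 : 0 ≤ y 0 := hpos 0
  have p1 : 0 ≤ y 1 := hpos 1
  have p2 : 0 ≤ y 2 := hpos 2
  have s0 : L * y 0 ≤ y 1 := hstep 0
  have s1 : L * y 1 ≤ y 2 := hstep 1
  have s2 : L * y 2 ≤ y 3 := hstep 2
  have q2 : y 0 * y 2 ≤ y 3 := (mul_le_mul_of_nonneg_right hw p2).trans s2
  have q1 : y 0 * (y 0 * y 1) ≤ y 3 :=
    (mul_le_mul_of_nonneg_left ((mul_le_mul_of_nonneg_right hw p1).trans s1) p0).trans q2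
  have q0 : y 0 ^ 4 ≤ y 3 := by
    have : y 0 * y 0 ≤ y 1 := (mul_le_mul_of_nonneg_right hw p0).trans s0
    calc y 0 ^ 4 = y 0 * (y 0 * (y 0 * y 0)) := by ring
      _ ≤ y 0 * (y 0 * y 1) := by gcongr
      _ ≤ y 3 := q1
  have : w ⬝ᵥ Y ^ 3 *ᵥ w = y 3 := rfl
  rw [this]
  -- Every term is at most `y 3` times its coefficient, and 4 + 4 + 2 + 4 + 1 = 15.
  nlinarith

lemma mul_trace_pow_three_le {S : Matrix ι ι ℝ} (hS : S.PosSemidef) {L : ℝ} (hL : 0 ≤ L) :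
    L * ((S + L • 1) ^ 3).trace ≤ ((S + L • 1) ^ 4).trace := by
  have e : (S + L • 1) ^ 4 = (S + L • 1) ^ 3 * S ^ 1 + L • (S + L • 1) ^ 3 := by
    rw [pow_succ _ 3, Matrix.mul_add, Matrix.mul_smul, Matrix.mul_one, pow_one]
  have h1 := (posSemidef_add_smul_one_pow_mul hS hL 3 1).trace_nonneg
  rw [e, trace_add, trace_smul, smul_eq_mul]
  linarith

end RankOne

/-! ### The fourth power trace of the error panel is of order `T ^ 5` -/

/-- Bounded random variables that are measurable for a given `σ`-algebra. -/
def BddMeasurable {Ω : Type*} (m : MeasurableSpace Ω) (X : Ω → ℝ) : Prop :=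
  Measurable[m] X ∧ ∃ c, ∀ ω, |X ω| ≤ c

namespace BddMeasurable

variable {Ω : Type*} {m : MeasurableSpace Ω} {X Y : Ω → ℝ}

lemma const (c : ℝ) : BddMeasurable m fun _ : Ω => c := ⟨measurable_const, |c|, fun _ => le_rfl⟩

lemma add (hX : BddMeasurable m X) (hY : BddMeasurable m Y) :
    BddMeasurable m fun ω => X ω + Y ω := by
  obtain ⟨hX, c, hc⟩ := hX
  obtain ⟨hY, d, hd⟩ := hY
  exact ⟨hX.add hY, c + d, fun ω => (abs_add_le _ _).trans (add_le_add (hc ω) (hd ω))⟩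

lemma mul (hX : BddMeasurable m X) (hY : BddMeasurable m Y) :
    BddMeasurable m fun ω => X ω * Y ω := by
  obtain ⟨hX, c, hc⟩ := hX
  obtain ⟨hY, d, hd⟩ := hY
  refine ⟨hX.mul hY, c * d, fun ω => ?_⟩
  rw [abs_mul]
  exact mul_le_mul (hc ω) (hd ω) (abs_nonneg _) ((abs_nonneg _).trans (hc ω))

lemma sum {κ : Type*} (s : Finset κ) {Z : κ → Ω → ℝ} (h : ∀ a ∈ s, BddMeasurable m (Z a)) :
    BddMeasurable m fun ω => ∑ a ∈ s, Z a ω := by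
  classical
  induction s using Finset.induction_on with
  | empty => simpa using const 0
  | insert a s ha ih =>
    simp_rw [Finset.sum_insert ha]
    exact (h a (Finset.mem_insert_self a s)).add
      (ih fun b hb => h b (Finset.mem_insert_of_mem hb))

lemma mono {m' : MeasurableSpace Ω} (hX : BddMeasurable m X) (h : m ≤ m') : BddMeasurable m' X :=
  ⟨hX.1.mono h le_rfl, hX.2⟩

lemma integrable (hX : BddMeasurable m X) {P : Measure Ω} [IsFiniteMeasure P] :
    Integrable X P := by
  obtain ⟨hX, c, hc⟩ := hX
  exact Integrable.mono' (integrable_const c) hX.aestronglyMeasurable (ae_of_all _ hc)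

lemma matrix_pow {ι : Type*} [Fintype ι] [DecidableEq ι] {Y : Ω → Matrix ι ι ℝ}
    (hY : ∀ i j, BddMeasurable m fun ω => Y ω i j) (p : ℕ) (i j : ι) :
    BddMeasurable m fun ω => (Y ω ^ p) i j := by
  induction p generalizing i j with
  | zero => simpa using const _
  | succ p ih =>
    simp_rw [pow_succ, mul_apply]
    exact sum _ fun l _ => (ih i l).mul (hY l j)

lemma trace {ι : Type*} [Fintype ι] {Y : Ω → Matrix ι ι ℝ}
    (hY : ∀ i j, BddMeasurable m fun ω => Y ω i j) : BddMeasurable m fun ω => (Y ω).trace :=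
  sum _ fun i _ => hY i i

end BddMeasurable

/-- A vector, set to zero when its squared length exceeds `L`. -/
def truncVec {n : ℕ} (L : ℝ) (w : Fin n → ℝ) : Fin n → ℝ := if w ⬝ᵥ w ≤ L then w else 0

lemma truncVec_dotProduct_le {n : ℕ} {L : ℝ} (hL : 0 ≤ L) (w : Fin n → ℝ) :
    truncVec L w ⬝ᵥ truncVec L w ≤ L := by
  unfold truncVec
  split_ifs with h
  · exact h
  · simpa using hL

/-- The second moment matrix of the truncated vectors of the first `t` periods. -/
def truncCov (n : ℕ) (L : ℝ) (η : ℕ → ℕ → ℝ) (t : ℕ) : Matrix (Fin n) (Fin n) ℝ :=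
  ∑ s ∈ Finset.range t,
    vecMulVec (truncVec L fun i : Fin n => η i s) (truncVec L fun i : Fin n => η i s)

lemma truncCov_succ (n : ℕ) (L : ℝ) (η : ℕ → ℕ → ℝ) (t : ℕ) :
    truncCov n L η (t + 1) = truncCov n L η t
      + vecMulVec (truncVec L fun i : Fin n => η i t) (truncVec L fun i : Fin n => η i t) :=
  Finset.sum_range_succ _ _

lemma truncCov_posSemidef (n : ℕ) (L : ℝ) (η : ℕ → ℕ → ℝ) (t : ℕ) :
    (truncCov n L η t).PosSemidef :=
  posSemidef_sum _ fun s _ => by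
    simpa using posSemidef_vecMulVec_self_star (truncVec L fun i : Fin n => η i s)

/-- On the event that no period is long, truncation changes nothing. -/
lemma truncCov_eq {n T : ℕ} {L : ℝ} {η : ℕ → ℕ → ℝ}
    (h : ∀ t < T, ∑ i ∈ Finset.range n, η i t ^ 2 ≤ L) :
    truncCov n L η T = panel n T η * (panel n T η)ᵀ := by
  ext i j
  rw [truncCov, Matrix.sum_apply, mul_apply, Finset.sum_range]
  refine Finset.sum_congr rfl fun t _ => ?_
  have := h t t.2
  rw [Finset.sum_range] at this
  rw [truncVec, if_pos]
  · rfl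
  · simpa [dotProduct, ← sq] using this

namespace ErrorModel

set_option linter.unusedSectionVars false

variable {Ω : Type*} [mΩ : MeasurableSpace Ω] {P : Measure Ω} [IsProbabilityMeasure P]
  {ν : ℕ → ℕ → Ω → ℝ} {A v : ℝ}

lemma bddMeasurable_truncVec {n : ℕ} {L : ℝ} (hL : 0 ≤ L) {S : Set ℕ} {t : ℕ} (ht : t ∈ S)
    (i : Fin n) : BddMeasurable (timesSigma ν S)
      fun ω => truncVec L (fun i : Fin n => ν i t ω) i := by
  have hm (j : ℕ) := measurable_timesSigma (ν := ν) ht j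
  constructor
  · have hset : MeasurableSet[timesSigma ν S]
        {ω | (fun i : Fin n => ν i t ω) ⬝ᵥ (fun i : Fin n => ν i t ω) ≤ L} :=
      measurableSet_le (Finset.measurable_sum _ fun j _ => (hm j).mul (hm j)) measurable_const
    have e : (fun ω => truncVec L (fun i : Fin n => ν i t ω) i) = fun ω =>
        if (fun i : Fin n => ν i t ω) ⬝ᵥ (fun i : Fin n => ν i t ω) ≤ L then ν i t ω else 0 := by
      ext ω
      unfold truncVec
      split_ifs <;> rfl
    rw [e]
    exact Measurable.ite hset (hm i) measurable_const
  · refine ⟨√L, fun ω => Real.abs_le_sqrt ?_⟩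
    refine le_trans ?_ (truncVec_dotProduct_le hL fun i : Fin n => ν i t ω)
    rw [sq]
    exact Finset.single_le_sum (f := fun i => truncVec L (fun i : Fin n => ν i t ω) i
      * truncVec L (fun i : Fin n => ν i t ω) i) (fun _ _ => mul_self_nonneg _) (Finset.mem_univ i)

lemma bddMeasurable_truncCov {n : ℕ} {L : ℝ} (hL : 0 ≤ L) (t : ℕ) (i j : Fin n) :
    BddMeasurable (timesSigma ν (Set.Iio t))
      fun ω => (truncCov n L (fun i t => ν i t ω) t + L • 1) i j := by
  simp_rw [Matrix.add_apply, truncCov, Matrix.sum_apply, vecMulVec_apply]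
  refine (BddMeasurable.sum _ fun s hs => ?_).add (BddMeasurable.const _)
  have hs' : s ∈ Set.Iio t := Finset.mem_range.1 hs
  exact (bddMeasurable_truncVec hL hs' i).mul (bddMeasurable_truncVec hL hs' j)

/-- The matrix depends on the past only, so it is independent of the current errors. Their cross
products have mean zero, and the trace is what remains. -/
lemma integral_quadratic_le (h : ErrorModel P ν A v) {n t : ℕ} {B : Ω → Matrix (Fin n) (Fin n) ℝ}
    (hB : ∀ i j, BddMeasurable (timesSigma ν (Set.Iio t)) fun ω => B ω i j)
    (hpos : ∀ ω i, 0 ≤ B ω i i) :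
    Integrable (fun ω => (fun i : Fin n => ν i t ω) ⬝ᵥ B ω *ᵥ (fun i : Fin n => ν i t ω)) P ∧
    ∫ ω, (fun i : Fin n => ν i t ω) ⬝ᵥ B ω *ᵥ (fun i : Fin n => ν i t ω) ∂P
      ≤ A * ∫ ω, (B ω).trace ∂P := by
  have e (ω : Ω) : (fun i : Fin n => ν i t ω) ⬝ᵥ B ω *ᵥ (fun i : Fin n => ν i t ω)
      = ∑ i, ∑ j, B ω i j * (ν i t ω * ν j t ω) := by
    simp only [dotProduct, mulVec, Finset.mul_sum]
    exact Finset.sum_congr rfl fun i _ => Finset.sum_congr rfl fun j _ => by ring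
  have hνm (i j : Fin n) : Measurable[timesSigma ν {t}] fun ω => ν i t ω * ν j t ω :=
    (measurable_timesSigma (Set.mem_singleton t) i).mul
      (measurable_timesSigma (Set.mem_singleton t) j)
  have hind (i j : Fin n) : IndepFun (fun ω => B ω i j) (fun ω => ν i t ω * ν j t ω) P :=
    h.indepFun_of_disjoint (S := Set.Iio t) (by simp) (hB i j).1 (hνm i j)
  have hBi (i j : Fin n) : Integrable (fun ω => B ω i j) P :=
    ((hB i j).mono (h.timesSigma_le _)).integrable
  have hint (i j : Fin n) : Integrable (fun ω => B ω i j * (ν i t ω * ν j t ω)) P :=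
    (hind i j).integrable_mul (hBi i j) (h.integrable_mul i t j t)
  have hval (i j : Fin n) : ∫ ω, B ω i j * (ν i t ω * ν j t ω) ∂P
      = (∫ ω, B ω i j ∂P) * ∫ ω, ν i t ω * ν j t ω ∂P :=
    (hind i j).integral_fun_mul_eq_mul_integral (hBi i j).aestronglyMeasurable
      (h.integrable_mul i t j t).aestronglyMeasurable
  simp_rw [e]
  refine ⟨integrable_finsetSum _ fun i _ => integrable_finsetSum _ fun j _ => hint i j, ?_⟩
  rw [integral_finsetSum _ fun i _ => integrable_finsetSum _ fun j _ => hint i j]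
  simp only [Matrix.trace, diag_apply]
  rw [integral_finsetSum _ fun i _ => hBi i i, Finset.mul_sum]
  refine Finset.sum_le_sum fun i _ => ?_
  rw [integral_finsetSum _ fun j _ => hint i j, Finset.sum_eq_single i]
  · rw [hval]
    simp_rw [← sq]
    have h1 : 0 ≤ ∫ ω, B ω i i ∂P := integral_nonneg fun ω => hpos ω i
    have h2 := h.sq_le i t
    nlinarith
  · intro j _ hji
    rw [hval, h.integral_mul_eq_zero, mul_zero]
    intro hij
    rw [Prod.mk.injEq] at hij
    exact hji (Fin.ext hij.1.symm)
  · simp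

/-- A discrete Gronwall argument. One period adds at most `15 w' Y ^ 3 w`, with mean at most `15 A E
tr Y ^ 3 ≤ (15 A / L) E tr Y ^ 4` because `Y ≥ L`. Truncation supplies `w'w ≤ L` and integrability.
-/
lemma integral_trace_truncCov_le (h : ErrorModel P ν A v) (n : ℕ) {L : ℝ} (hL : 0 < L) (t : ℕ) :
    ∫ ω, ((truncCov n L (fun i t => ν i t ω) t + L • 1) ^ 4).trace ∂P
      ≤ n * L ^ 4 * Real.exp (15 * A / L * t) := by
  have hA := h.bound_pos
  induction t with
  | zero =>
    simp [truncCov, smul_pow, mul_comm]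
  | succ t ih =>
    set Y : Ω → Matrix (Fin n) (Fin n) ℝ := fun ω =>
      truncCov n L (fun i t => ν i t ω) t + L • 1 with hY
    have hYb (i j : Fin n) : BddMeasurable (timesSigma ν (Set.Iio t)) fun ω => Y ω i j :=
      bddMeasurable_truncCov hL.le t i j
    have hS (ω : Ω) := truncCov_posSemidef n L (fun i t => ν i t ω) t
    have hY3 (ω : Ω) : (Y ω ^ 3).PosSemidef := by
      simpa using posSemidef_add_smul_one_pow_mul (hS ω) hL.le 3 0
    have hq := h.integral_quadratic_le (BddMeasurable.matrix_pow hYb 3)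
      fun ω i => (hY3 ω).diag_nonneg
    have hi4 : Integrable (fun ω => (Y ω ^ 4).trace) P :=
      ((BddMeasurable.trace (BddMeasurable.matrix_pow hYb 4)).mono (h.timesSigma_le _)).integrable
    have hi3 : Integrable (fun ω => (Y ω ^ 3).trace) P :=
      ((BddMeasurable.trace (BddMeasurable.matrix_pow hYb 3)).mono (h.timesSigma_le _)).integrable
    have hi5 : Integrable
        (fun ω => ((truncCov n L (fun i t => ν i t ω) (t + 1) + L • 1) ^ 4).trace) P :=
      ((BddMeasurable.trace (BddMeasurable.matrix_pow
        (bddMeasurable_truncCov hL.le (t + 1)) 4)).mono (h.timesSigma_le _)).integrable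
    -- Dropping the truncation in the quadratic form only enlarges it, and makes the centred errors
    -- available.
    have hpt (ω : Ω) : ((truncCov n L (fun i t => ν i t ω) (t + 1) + L • 1) ^ 4).trace
        ≤ (Y ω ^ 4).trace
          + 15 * ((fun i : Fin n => ν i t ω) ⬝ᵥ Y ω ^ 3 *ᵥ (fun i : Fin n => ν i t ω)) := by
      have e : truncCov n L (fun i t => ν i t ω) (t + 1) + L • 1
          = Y ω + vecMulVec (truncVec L fun i : Fin n => ν i t ω)
            (truncVec L fun i : Fin n => ν i t ω) := by
        rw [truncCov_succ, add_right_comm]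
      rw [e]
      refine (trace_add_vecMulVec_pow_four_le (hS ω) hL.le
        (truncVec_dotProduct_le hL.le _)).trans ?_
      have h0 := (hY3 ω).dotProduct_mulVec_nonneg (fun i : Fin n => ν i t ω)
      rw [star_trivial] at h0
      gcongr
      unfold truncVec
      split_ifs
      · exact le_rfl
      · simpa using h0
    have hstep : ∫ ω, ((truncCov n L (fun i t => ν i t ω) (t + 1) + L • 1) ^ 4).trace ∂P
        ≤ ∫ ω, (Y ω ^ 4).trace ∂P + 15 * (A * ∫ ω, (Y ω ^ 3).trace ∂P) := by
      refine (integral_mono hi5 (hi4.add (hq.1.const_mul 15)) hpt).trans ?_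
      rw [integral_add' hi4 (hq.1.const_mul 15), integral_const_mul]
      linarith [hq.2]
    have h34 : L * ∫ ω, (Y ω ^ 3).trace ∂P ≤ ∫ ω, (Y ω ^ 4).trace ∂P := by
      rw [← integral_const_mul]
      exact integral_mono (hi3.const_mul L) hi4 fun ω => mul_trace_pow_three_le (hS ω) hL.le
    have h34' : ∫ ω, (Y ω ^ 3).trace ∂P ≤ (∫ ω, (Y ω ^ 4).trace ∂P) / L := by
      rw [le_div_iff₀ hL]; linarith
    have hexp := Real.add_one_le_exp (15 * A / L)
    have h40 : 0 ≤ ∫ ω, (Y ω ^ 4).trace ∂P := integral_nonneg fun ω => by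
      simpa using (posSemidef_add_smul_one_pow_mul (hS ω) hL.le 4 0).trace_nonneg
    calc _ ≤ ∫ ω, (Y ω ^ 4).trace ∂P + 15 * (A * ((∫ ω, (Y ω ^ 4).trace ∂P) / L)) := by
          refine hstep.trans ?_
          gcongr
      _ = (15 * A / L + 1) * ∫ ω, (Y ω ^ 4).trace ∂P := by ring
      _ ≤ Real.exp (15 * A / L) * (n * L ^ 4 * Real.exp (15 * A / L * t)) := by gcongr
      _ = _ := by
        push_cast
        rw [mul_add, mul_one, Real.exp_add]
        ring

/-- The fourth power of the uncentred second moment matrix of the errors has a trace of the order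
`T ^ 5` in probability. -/
theorem measureReal_trace_gt_le (h : ErrorModel P ν A v) {n T : ℕ} {C a H : ℝ} (hT : 0 < T)
    (hn : (n : ℝ) ≤ C * T) (ha : 0 < a) (haC : 2 * A * C ≤ a) (hH : 0 < H) :
    P.real {ω | H * T ^ 5 < ((panel n T (fun i t => ν i t ω)
        * (panel n T fun i t => ν i t ω)ᵀ) ^ 4).trace}
      ≤ 4 * A * C / a ^ 2 + C * a ^ 4 * Real.exp (15 * A / a) / H := by
  have hA := h.bound_pos
  have hT' : (0 : ℝ) < T := by exact_mod_cast hT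
  set L := a * T with hL
  have hL0 : 0 < L := by positivity
  set f : Ω → ℝ := fun ω => ((truncCov n L (fun i t => ν i t ω) T + L • 1) ^ 4).trace with hf
  have hf0 (ω : Ω) : 0 ≤ f ω := by
    simpa using (posSemidef_add_smul_one_pow_mul
      (truncCov_posSemidef n L (fun i t => ν i t ω) T) hL0.le 4 0).trace_nonneg
  have hfi : Integrable f P :=
    ((BddMeasurable.trace (BddMeasurable.matrix_pow
      (bddMeasurable_truncCov hL0.le T) 4)).mono (h.timesSigma_le _)).integrable
  have hsub : {ω | H * T ^ 5 < ((panel n T (fun i t => ν i t ω)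
        * (panel n T fun i t => ν i t ω)ᵀ) ^ 4).trace}
      ⊆ (⋃ t ∈ Finset.range T, {ω | L < ∑ i ∈ Finset.range n, ν i t ω ^ 2})
        ∪ {ω | H * T ^ 5 ≤ f ω} := by
    intro ω hω
    by_cases hc : ∀ t < T, ∑ i ∈ Finset.range n, ν i t ω ^ 2 ≤ L
    · right
      have h1 := trace_pow_add_le (truncCov_posSemidef n L (fun i t => ν i t ω) T) hL0.le 4 0
      rw [pow_zero, Matrix.mul_one, zero_add, truncCov_eq hc] at h1
      refine (le_of_lt hω).trans (h1.trans (le_of_eq ?_))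
      simp only [hf]
      rw [truncCov_eq hc]
    · left
      push Not at hc
      obtain ⟨t, ht, h2⟩ := hc
      simp only [Set.mem_iUnion, Finset.mem_range]
      exact ⟨t, ht, h2⟩
  refine (measureReal_mono hsub (measure_ne_top _ _)).trans ((measureReal_union_le _ _).trans ?_)
  refine add_le_add ?_ ?_
  · refine (measureReal_biUnion_finset_le _ _).trans ?_
    refine (Finset.sum_le_sum fun t _ => h.measureReal_sum_sq_gt_le hT hn ha haC t).trans ?_
    rw [Finset.sum_const, Finset.card_range, nsmul_eq_mul]
    apply le_of_eq
    field_simp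
  · have h1 := mul_meas_ge_le_integral_of_nonneg (ae_of_all P hf0) hfi (H * T ^ 5)
    have h2 : ∫ ω, f ω ∂P ≤ _ := h.integral_trace_truncCov_le n hL0 T
    -- With `L = a T` the growth over all `T` periods stays bounded.
    have e : 15 * A / L * T = 15 * A / a := by rw [hL]; field_simp
    rw [e] at h2
    rw [le_div_iff₀ hH]
    have h3 : P.real {ω | H * T ^ 5 ≤ f ω} * H * T ^ 5
        ≤ C * a ^ 4 * Real.exp (15 * A / a) * T ^ 5 := by
      calc _ = H * T ^ 5 * P.real {ω | H * T ^ 5 ≤ f ω} := by ring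
        _ ≤ n * L ^ 4 * Real.exp (15 * A / a) := h1.trans h2
        _ ≤ (C * T) * L ^ 4 * Real.exp (15 * A / a) := by gcongr
        _ = _ := by rw [hL]; ring
    exact le_of_mul_le_mul_right h3 (by positivity)

end ErrorModel

/-! ### Exchangeable columns with zero row sums -/

section Exchangeable

variable {Ω : Type*} [MeasurableSpace Ω] {P : Measure Ω} [IsProbabilityMeasure P]

/-- The second moment of the pairing of a random matrix with exchangeable columns that sum to zero
with a fixed matrix whose columns sum to zero. -/
theorem integral_sq_sum_mul_le_of_exchangeable {n T : ℕ} (hT : 2 ≤ T)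
    {b : Fin n → Fin T → Ω → ℝ} (hint : ∀ i j s t, Integrable (fun ω => b i s ω * b j t ω) P)
    (hdiag : ∀ i j s s', ∫ ω, b i s ω * b j s ω ∂P = ∫ ω, b i s' ω * b j s' ω ∂P)
    (hoff : ∀ i j s t s' t', s ≠ t → s' ≠ t' →
      ∫ ω, b i s ω * b j t ω ∂P = ∫ ω, b i s' ω * b j t' ω ∂P)
    (hzero : ∀ i ω, ∑ t, b i t ω = 0) {B : ℝ}
    (hB : ∀ ω (x : Fin n → ℝ), ∑ t, (∑ i, x i * b i t ω) ^ 2 ≤ B * ∑ i, x i ^ 2)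
    (U : Matrix (Fin n) (Fin T) ℝ) (hU : ∀ i, ∑ t, U i t = 0) :
    Integrable (fun ω => (∑ i, ∑ t, U i t * b i t ω) ^ 2) P ∧
    ∫ ω, (∑ i, ∑ t, U i t * b i t ω) ^ 2 ∂P ≤ B / (T - 1) * frob U ^ 2 := by
  have hT' : (2 : ℝ) ≤ T := by exact_mod_cast hT
  have hT1 : (0 : ℝ) < T - 1 := by linarith
  let t₀ : Fin T := ⟨0, by omega⟩
  set C : Fin n → Fin n → ℝ := fun i j => ∫ ω, b i t₀ ω * b j t₀ ω ∂P with hC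
  -- For fixed rows, exchangeability leaves one diagonal and one off-diagonal value; zero row sums
  -- force the latter to be `-1 / (T - 1)` times the former.
  have hcov (i j : Fin n) (s t : Fin T) :
      ∫ ω, b i s ω * b j t ω ∂P = ((if s = t then (T : ℝ) else 0) - 1) / (T - 1) * C i j := by
    split_ifs with hst
    · subst hst
      rw [div_self hT1.ne', one_mul]
      exact hdiag i j s t₀
    · have h0 : ∑ u, ∫ ω, b i s ω * b j u ω ∂P = 0 := by
        rw [← integral_finsetSum _ fun u _ => hint i j s u]
        simp_rw [← Finset.mul_sum, hzero, mul_zero, integral_zero]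
      rw [← Finset.add_sum_erase _ _ (Finset.mem_univ s), hdiag i j s t₀,
        Finset.sum_congr rfl fun u hu =>
          hoff i j s u s t (Finset.ne_of_mem_erase hu).symm hst] at h0
      rw [Finset.sum_const, Finset.card_erase_of_mem (Finset.mem_univ s), Finset.card_univ,
        Fintype.card_fin, nsmul_eq_mul, Nat.cast_sub (by omega)] at h0
      rw [zero_sub, div_mul_eq_mul_div, eq_div_iff hT1.ne']
      push_cast at h0
      simp only [hC]
      linarith
  -- All periods have the same quadratic form, so it is bounded by the average over time of the
  -- pointwise bound.
  have hq (x : Fin n → ℝ) : ∑ i, ∑ j, x i * x j * C i j ≤ B / T * ∑ i, x i ^ 2 := by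
    have e (t : Fin T) : ∫ ω, (∑ i, x i * b i t ω) ^ 2 ∂P = ∑ i, ∑ j, x i * x j * C i j := by
      have e1 (ω : Ω) : (∑ i, x i * b i t ω) ^ 2
          = ∑ i, ∑ j, x i * x j * (b i t ω * b j t ω) := by
        rw [sq, Finset.sum_mul_sum]
        exact Finset.sum_congr rfl fun i _ => Finset.sum_congr rfl fun j _ => by ring
      simp_rw [e1]
      rw [integral_finsetSum _ fun i _ => integrable_finsetSum _ fun j _ =>
        (hint i j t t).const_mul _]
      refine Finset.sum_congr rfl fun i _ => ?_
      rw [integral_finsetSum _ fun j _ => (hint i j t t).const_mul _]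
      refine Finset.sum_congr rfl fun j _ => ?_
      rw [integral_const_mul, hdiag i j t t₀]
    have hi (t : Fin T) : Integrable (fun ω => (∑ i, x i * b i t ω) ^ 2) P := by
      have e1 (ω : Ω) : (∑ i, x i * b i t ω) ^ 2
          = ∑ i, ∑ j, x i * x j * (b i t ω * b j t ω) := by
        rw [sq, Finset.sum_mul_sum]
        exact Finset.sum_congr rfl fun i _ => Finset.sum_congr rfl fun j _ => by ring
      simp_rw [e1]
      exact integrable_finsetSum _ fun i _ => integrable_finsetSum _ fun j _ =>
        (hint i j t t).const_mul _
    have h1 : ∑ t : Fin T, ∫ ω, (∑ i, x i * b i t ω) ^ 2 ∂P ≤ B * ∑ i, x i ^ 2 := by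
      rw [← integral_finsetSum _ fun t _ => hi t]
      refine (integral_mono (integrable_finsetSum _ fun t _ => hi t) (integrable_const _)
        fun ω => hB ω x).trans ?_
      simp
    simp_rw [e] at h1
    rw [Finset.sum_const, Finset.card_univ, Fintype.card_fin, nsmul_eq_mul] at h1
    rw [div_mul_eq_mul_div, le_div_iff₀ (by linarith)]
    linarith
  have e (ω : Ω) : (∑ i, ∑ t, U i t * b i t ω) ^ 2
      = ∑ i, ∑ j, ∑ s, ∑ t, U i s * U j t * (b i s ω * b j t ω) := by
    rw [sq, Finset.sum_mul_sum]
    refine Finset.sum_congr rfl fun i _ => Finset.sum_congr rfl fun j _ => ?_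
    rw [Finset.sum_mul_sum]
    exact Finset.sum_congr rfl fun s _ => Finset.sum_congr rfl fun t _ => by ring
  have hi (i j : Fin n) (s t : Fin T) :
      Integrable (fun ω => U i s * U j t * (b i s ω * b j t ω)) P := (hint i j s t).const_mul _
  have hi1 (i j : Fin n) (s : Fin T) := integrable_finsetSum Finset.univ fun t _ => hi i j s t
  have hi2 (i j : Fin n) := integrable_finsetSum Finset.univ fun s _ => hi1 i j s
  have hi3 (i : Fin n) := integrable_finsetSum Finset.univ fun j _ => hi2 i j
  simp_rw [e]
  refine ⟨integrable_finsetSum Finset.univ fun i _ => hi3 i, ?_⟩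
  -- The part of the covariance that is constant in time is annihilated by the centred rows of `U`.
  have hval (i j : Fin n) : ∑ s, ∑ t, ∫ ω, U i s * U j t * (b i s ω * b j t ω) ∂P
      = T / (T - 1) * ∑ s, U i s * U j s * C i j := by
    simp_rw [integral_const_mul, hcov]
    have e1 (s t : Fin T) : U i s * U j t * (((if s = t then (T : ℝ) else 0) - 1) / (T - 1) * C i j)
        = (if s = t then T / (T - 1) * (U i s * U j t * C i j) else 0)
          - C i j / (T - 1) * (U i s * U j t) := by
      split_ifs <;> ring
    simp_rw [e1, Finset.sum_sub_distrib, Finset.sum_ite_eq, Finset.mem_univ, if_true,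
      ← Finset.mul_sum, hU, mul_zero, Finset.sum_const_zero, mul_zero, sub_zero]
  have h2 : ∫ ω, ∑ i, ∑ j, ∑ s, ∑ t, U i s * U j t * (b i s ω * b j t ω) ∂P
      = T / (T - 1) * ∑ s, ∑ i, ∑ j, U i s * U j s * C i j := by
    rw [integral_finsetSum _ fun i _ => hi3 i]
    simp_rw [integral_finsetSum Finset.univ fun j _ => hi2 _ j,
      integral_finsetSum Finset.univ fun s _ => hi1 _ _ s,
      integral_finsetSum Finset.univ fun t _ => hi _ _ _ t, hval, ← Finset.mul_sum]
    congr 1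
    rw [Finset.sum_comm]
    simp_rw [Finset.sum_comm (s := (Finset.univ : Finset (Fin n)))
      (t := (Finset.univ : Finset (Fin T)))]
    refine Finset.sum_congr rfl fun s _ => ?_
    rw [Finset.sum_comm]
  rw [h2]
  calc T / (T - 1) * ∑ s, ∑ i, ∑ j, U i s * U j s * C i j
      ≤ T / (T - 1) * ∑ s, B / T * ∑ i, U i s ^ 2 :=
        mul_le_mul_of_nonneg_left (Finset.sum_le_sum fun s _ => hq fun i => U i s) (by positivity)
    _ = B / (T - 1) * frob U ^ 2 := by
        rw [← Finset.mul_sum, frob_sq, Finset.sum_comm]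
        field_simp

lemma exists_perm_apply_eq {τ : Type*} [DecidableEq τ] {s t s' t' : τ} (h : s ≠ t)
    (h' : s' ≠ t') : ∃ π : Equiv.Perm τ, π s = s' ∧ π t = t' := by
  refine ⟨Equiv.swap (Equiv.swap s s' t) t' * Equiv.swap s s', ?_, ?_⟩
  · rw [Equiv.Perm.mul_apply, Equiv.swap_apply_left, Equiv.swap_apply_of_ne_of_ne _ h']
    intro h1
    rw [eq_comm, Equiv.swap_apply_eq_iff, Equiv.swap_apply_right] at h1
    exact h h1.symm
  · rw [Equiv.Perm.mul_apply, Equiv.swap_apply_left]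

end Exchangeable

/-! ### Measurability of the statistic and its gradient -/

section Measurability

set_option linter.unusedSectionVars false

variable {Ω : Type*} [MeasurableSpace Ω] {ι τ σ : Type*} [Fintype ι] [Fintype τ] [Fintype σ]

lemma measurable_matrix_mul {F : Ω → Matrix ι τ ℝ} {G : Ω → Matrix τ σ ℝ}
    (hF : ∀ i j, Measurable fun ω => F ω i j) (hG : ∀ i j, Measurable fun ω => G ω i j) (i : ι)
    (j : σ) : Measurable fun ω => (F ω * G ω) i j := by
  simp_rw [mul_apply]
  exact Finset.measurable_sum _ fun l _ => (hF i l).mul (hG l j)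

lemma measurable_matrix_pow [DecidableEq ι] {F : Ω → Matrix ι ι ℝ}
    (hF : ∀ i j, Measurable fun ω => F ω i j) (p : ℕ) (i j : ι) :
    Measurable fun ω => (F ω ^ p) i j := by
  induction p generalizing i j with
  | zero => simp
  | succ p ih =>
    simp_rw [pow_succ]
    exact measurable_matrix_mul ih hF i j

lemma measurable_matrix_trace {F : Ω → Matrix ι ι ℝ} (hF : ∀ i j, Measurable fun ω => F ω i j) :
    Measurable fun ω => (F ω).trace :=
  Finset.measurable_sum _ fun i _ => hF i i

variable {Z : Ω → Matrix ι τ ℝ}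

lemma measurable_rowNorm (hZ : ∀ i t, Measurable fun ω => Z ω i t) (i : ι) :
    Measurable fun ω => rowNorm (Z ω) i :=
  (Finset.measurable_sum _ fun t _ => (hZ i t).pow_const 2).sqrt

lemma measurable_normRows (hZ : ∀ i t, Measurable fun ω => Z ω i t) (i : ι) (t : τ) :
    Measurable fun ω => normRows (Z ω) i t :=
  (measurable_rowNorm hZ i).inv.mul (hZ i t)

lemma measurable_rowCorr (hZ : ∀ i t, Measurable fun ω => Z ω i t) (i j : ι) :
    Measurable fun ω => rowCorr (Z ω) i j :=
  measurable_matrix_mul (measurable_normRows hZ) (fun t j => measurable_normRows hZ j t) i j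

lemma measurable_trace_rowCorr_pow [DecidableEq ι] (hZ : ∀ i t, Measurable fun ω => Z ω i t)
    (p : ℕ) : Measurable fun ω => (rowCorr (Z ω) ^ p).trace :=
  measurable_matrix_trace (measurable_matrix_pow (measurable_rowCorr hZ) p)

lemma measurable_corrGrad [DecidableEq ι] (hZ : ∀ i t, Measurable fun ω => Z ω i t) (i : ι)
    (t : τ) : Measurable fun ω => corrGrad (Z ω) i t :=
  (measurable_rowNorm hZ i).inv.mul
    ((measurable_matrix_mul (measurable_matrix_pow (measurable_rowCorr hZ) 3)
      (measurable_normRows hZ) i t).sub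
      ((measurable_matrix_pow (measurable_rowCorr hZ) 4 i i).mul (measurable_normRows hZ i t)))

end Measurability

/-! ### The gradient restricted to well-conditioned panels -/

section CentreRows

open scoped Matrix.Norms.L2Operator

variable {n T : ℕ}

/-- The matrix with its rows centred. -/
def centreRows (Z : Matrix (Fin n) (Fin T) ℝ) : Matrix (Fin n) (Fin T) ℝ :=
  of fun i t => Z i t - (T : ℝ)⁻¹ * ∑ s, Z i s

lemma centreRows_apply (Z : Matrix (Fin n) (Fin T) ℝ) (i : Fin n) (t : Fin T) :
    centreRows Z i t = Z i t - (T : ℝ)⁻¹ * ∑ s, Z i s := rfl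

lemma centeredPanel_eq_centreRows (n T : ℕ) (η : ℕ → ℕ → ℝ) :
    centeredPanel n T η = centreRows (panel n T η) := by
  ext i t
  rw [centeredPanel_apply, centreRows_apply, centered, Finset.sum_range]
  rfl

lemma sum_sub_mean_eq_zero (y : Fin T → ℝ) : ∑ t, (y t - (T : ℝ)⁻¹ * ∑ s, y s) = 0 := by
  rcases Nat.eq_zero_or_pos T with rfl | hT
  · simp
  have hT' : (T : ℝ) ≠ 0 := by exact_mod_cast hT.ne'
  rw [Finset.sum_sub_distrib, Finset.sum_const, Finset.card_univ, Fintype.card_fin, nsmul_eq_mul,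
    mul_inv_cancel_left₀ hT', sub_self]

lemma sum_centreRows (Z : Matrix (Fin n) (Fin T) ℝ) (i : Fin n) : ∑ t, centreRows Z i t = 0 :=
  sum_sub_mean_eq_zero (Z i)

lemma centreRows_submatrix (Z : Matrix (Fin n) (Fin T) ℝ) (π : Equiv.Perm (Fin T)) :
    centreRows (Z.submatrix id π) = (centreRows Z).submatrix id π := by
  ext i t
  simp only [centreRows_apply, submatrix_apply, id]
  rw [Equiv.sum_comp π fun s => Z i s]

lemma sum_sub_mean_sq_le (y : Fin T → ℝ) :
    ∑ t, (y t - (T : ℝ)⁻¹ * ∑ s, y s) ^ 2 ≤ ∑ t, y t ^ 2 := by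
  set m := (T : ℝ)⁻¹ * ∑ s, y s with hm
  have e (t : Fin T) : (y t - m) ^ 2 = y t ^ 2 - m ^ 2 - 2 * m * (y t - m) := by ring
  simp_rw [e, Finset.sum_sub_distrib, ← Finset.mul_sum]
  have h0 : ∑ t, (y t - m) = 0 := sum_sub_mean_eq_zero y
  rw [h0, mul_zero, sub_zero]
  have : 0 ≤ ∑ _t : Fin T, m ^ 2 := Finset.sum_nonneg fun _ _ => sq_nonneg _
  linarith

/-- Seen through the transpose, centring subtracts the mean from the vector `Z' u`, which does not
lengthen it. -/
lemma opNorm_centreRows_le (Z : Matrix (Fin n) (Fin T) ℝ) : ‖centreRows Z‖ ≤ ‖Z‖ := by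
  rw [← opNorm_transpose]
  refine opNorm_le_of_sum_mulVec_sq_le (norm_nonneg _) fun u => ?_
  have e (t : Fin T) : ((centreRows Z)ᵀ *ᵥ u) t
      = (Zᵀ *ᵥ u) t - (T : ℝ)⁻¹ * ∑ s, (Zᵀ *ᵥ u) s := by
    simp only [mulVec, dotProduct, transpose_apply, centreRows_apply, sub_mul,
      Finset.sum_sub_distrib]
    rw [Finset.sum_comm, Finset.mul_sum]
    simp_rw [← Finset.sum_mul, mul_assoc]
  simp_rw [e]
  refine (sum_sub_mean_sq_le _).trans ?_
  rw [← opNorm_transpose Z]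
  exact sum_mulVec_sq_le Zᵀ u

/-- Panels with long centred rows and a small spectral norm. -/
def WellConditioned (κ H : ℝ) (Z : Matrix (Fin n) (Fin T) ℝ) : Prop :=
  (∀ i, κ * T ≤ rowNorm (centreRows Z) i ^ 2) ∧ ((Z * Zᵀ) ^ 4).trace ≤ H * T ^ 5

/-- Restriction to these panels bounds the gradient without destroying exchangeability. -/
lemma wellConditioned_submatrix {κ H : ℝ} (Z : Matrix (Fin n) (Fin T) ℝ)
    (π : Equiv.Perm (Fin T)) :
    WellConditioned κ H (Z.submatrix id π) ↔ WellConditioned κ H Z := by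
  simp only [WellConditioned, centreRows_submatrix, rowNorm_submatrix, submatrix_mul_transpose]

lemma measurable_centreRows {Ω : Type*} [MeasurableSpace Ω] {Z : Ω → Matrix (Fin n) (Fin T) ℝ}
    (hZ : ∀ i t, Measurable fun ω => Z ω i t) (i : Fin n) (t : Fin T) :
    Measurable fun ω => centreRows (Z ω) i t :=
  (hZ i t).sub ((Finset.measurable_sum _ fun s _ => hZ i s).const_mul _)

lemma measurableSet_wellConditioned {Ω : Type*} [MeasurableSpace Ω] {κ H : ℝ}
    {Z : Ω → Matrix (Fin n) (Fin T) ℝ} (hZ : ∀ i t, Measurable fun ω => Z ω i t) :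
    MeasurableSet {ω | WellConditioned κ H (Z ω)} := by
  have e : {ω | WellConditioned κ H (Z ω)}
      = (⋂ i, {ω | κ * T ≤ rowNorm (centreRows (Z ω)) i ^ 2})
        ∩ {ω | ((Z ω * (Z ω)ᵀ) ^ 4).trace ≤ H * T ^ 5} := by
    ext ω
    simp [WellConditioned]
  rw [e]
  refine MeasurableSet.inter ?_ ?_
  · exact MeasurableSet.iInter fun i => measurableSet_le measurable_const
      ((measurable_rowNorm (measurable_centreRows hZ) i).pow_const 2)
  · exact measurableSet_le (measurable_matrix_trace (measurable_matrix_pow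
      (measurable_matrix_mul hZ fun t i => hZ i t) 4)) measurable_const

lemma WellConditioned.le_rowNorm {κ H : ℝ} {Z : Matrix (Fin n) (Fin T) ℝ}
    (h : WellConditioned κ H Z) (i : Fin n) : √(κ * T) ≤ rowNorm (centreRows Z) i :=
  Real.sqrt_le_iff.2 ⟨rowNorm_nonneg _ _, h.1 i⟩

/-- The condition on `K` compares `‖Z‖ ^ 8 ≤ H T ^ 5` with the eighth power of the row lengths, at
least `κ ^ 4 T ^ 4`. -/
lemma WellConditioned.opNorm_normRows_le {κ H : ℝ} {Z : Matrix (Fin n) (Fin T) ℝ}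
    (h : WellConditioned κ H Z) (hκ : 0 < κ) (hT : 0 < T) {K : ℝ} (hK : 0 ≤ K)
    (hHK : H * T ≤ κ ^ 4 * K ^ 8) : ‖normRows (centreRows Z)‖ ≤ K := by
  have hT' : (0 : ℝ) < T := by exact_mod_cast hT
  have hρ : 0 < √(κ * T) := by positivity
  have e : normRows (centreRows Z)
      = diagonal (fun i => (rowNorm (centreRows Z) i)⁻¹) * centreRows Z := by
    ext i t
    rw [diagonal_mul, normRows_apply]
  have h1 : ‖normRows (centreRows Z)‖ ≤ (√(κ * T))⁻¹ * ‖Z‖ := by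
    rw [e]
    refine (l2_opNorm_mul _ _).trans (mul_le_mul ?_ (opNorm_centreRows_le Z) (norm_nonneg _)
      (by positivity))
    refine opNorm_diagonal_le (by positivity) fun i => ?_
    rw [abs_of_nonneg (inv_nonneg.2 (rowNorm_nonneg _ _))]
    exact inv_anti₀ hρ (h.le_rowNorm i)
  have h2 : ‖Z‖ ^ 8 ≤ H * T ^ 5 := (opNorm_pow_eight_le_trace Z).trans h.2
  have h3 : √(κ * T) ^ 8 = κ ^ 4 * T ^ 4 := by
    rw [show (8 : ℕ) = 2 * 4 by norm_num, pow_mul, Real.sq_sqrt (by positivity), mul_pow]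
  refine h1.trans (le_of_pow_le_pow_left₀ (n := 8) (by norm_num) hK ?_)
  rw [mul_pow, inv_pow, h3, inv_mul_le_iff₀ (by positivity)]
  calc ‖Z‖ ^ 8 ≤ H * T ^ 5 := h2
    _ = H * T * T ^ 4 := by ring
    _ ≤ κ ^ 4 * K ^ 8 * T ^ 4 := by gcongr
    _ = _ := by ring

open scoped Classical in
/-- The gradient of the trace statistic at the centred panel, set to zero outside the
well-conditioned panels. -/
def centredGrad (κ H : ℝ) (Z : Matrix (Fin n) (Fin T) ℝ) : Matrix (Fin n) (Fin T) ℝ :=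
  if WellConditioned κ H Z then corrGrad (centreRows Z) else 0

lemma centredGrad_submatrix (κ H : ℝ) (Z : Matrix (Fin n) (Fin T) ℝ) (π : Equiv.Perm (Fin T))
    (i : Fin n) (t : Fin T) :
    centredGrad κ H (Z.submatrix id π) i t = centredGrad κ H Z i (π t) := by
  by_cases h : WellConditioned κ H Z
  · rw [centredGrad, if_pos ((wellConditioned_submatrix Z π).2 h), centredGrad, if_pos h,
      centreRows_submatrix, corrGrad_submatrix]
    rfl
  · rw [centredGrad, if_neg (mt (wellConditioned_submatrix Z π).1 h), centredGrad, if_neg h]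
    rfl

lemma sum_centredGrad (κ H : ℝ) (Z : Matrix (Fin n) (Fin T) ℝ) (i : Fin n) :
    ∑ t, centredGrad κ H Z i t = 0 := by
  unfold centredGrad
  split_ifs
  · exact sum_corrGrad _ (sum_centreRows _) i
  · simp

lemma measurable_centredGrad {Ω : Type*} [MeasurableSpace Ω] {κ H : ℝ}
    {Z : Ω → Matrix (Fin n) (Fin T) ℝ} (hZ : ∀ i t, Measurable fun ω => Z ω i t) (i : Fin n)
    (t : Fin T) : Measurable fun ω => centredGrad κ H (Z ω) i t := by
  have e : (fun ω => centredGrad κ H (Z ω) i t)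
      = Set.indicator {ω | WellConditioned κ H (Z ω)}
        (fun ω => corrGrad (centreRows (Z ω)) i t) := by
    ext ω
    by_cases h : WellConditioned κ H (Z ω) <;> simp [centredGrad, h]
  rw [e]
  exact (measurable_corrGrad (measurable_centreRows hZ) i t).indicator
    (measurableSet_wellConditioned hZ)

lemma sum_mul_centredGrad_sq_le {κ H K : ℝ} (hκ : 0 < κ) (hT : 0 < T) (hK : 0 ≤ K)
    (hHK : H * T ≤ κ ^ 4 * K ^ 8) (Z : Matrix (Fin n) (Fin T) ℝ) (x : Fin n → ℝ) :
    ∑ t, (∑ i, x i * centredGrad κ H Z i t) ^ 2 ≤ 4 * K ^ 14 / (κ * T) * ∑ i, x i ^ 2 := by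
  have hT' : (0 : ℝ) < T := by exact_mod_cast hT
  have hx : 0 ≤ ∑ i, x i ^ 2 := Finset.sum_nonneg fun _ _ => sq_nonneg _
  by_cases hZ : WellConditioned κ H Z
  · simp only [centredGrad, if_pos hZ]
    have h1 := opNorm_corrGrad_le (ρ := √(κ * T)) (by positivity) hZ.le_rowNorm
      (hZ.opNorm_normRows_le hκ hT hK hHK)
    have h2 := sum_mulVec_sq_le (corrGrad (centreRows Z))ᵀ x
    have e (t : Fin T) : ((corrGrad (centreRows Z))ᵀ *ᵥ x) t
        = ∑ i, x i * corrGrad (centreRows Z) i t := by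
      simp [mulVec, dotProduct, mul_comm]
    simp_rw [e] at h2
    refine h2.trans (mul_le_mul_of_nonneg_right ?_ hx)
    rw [opNorm_transpose]
    refine (pow_le_pow_left₀ (norm_nonneg _) h1 2).trans (le_of_eq ?_)
    rw [div_pow, Real.sq_sqrt (by positivity)]
    ring
  · simp only [centredGrad, if_neg hZ, Matrix.zero_apply, mul_zero, Finset.sum_const_zero]
    rw [zero_pow two_ne_zero, Finset.sum_const_zero]
    positivity

/-- A crude bound that serves only for integrability. -/
lemma abs_centredGrad_le {κ H K : ℝ} (hκ : 0 < κ) (hT : 0 < T) (hK : 0 ≤ K)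
    (hHK : H * T ≤ κ ^ 4 * K ^ 8) (Z : Matrix (Fin n) (Fin T) ℝ) (i : Fin n) (t : Fin T) :
    |centredGrad κ H Z i t| ≤ √(4 * K ^ 14 / (κ * T)) := by
  apply Real.abs_le_sqrt
  have h1 := sum_mul_centredGrad_sq_le hκ hT hK hHK Z (Pi.single i 1)
  have e (s : Fin T) : ∑ j, (Pi.single i 1 : Fin n → ℝ) j * centredGrad κ H Z j s
      = centredGrad κ H Z i s := by
    simp [Pi.single_apply]
  have e2 : ∑ j, (Pi.single i 1 : Fin n → ℝ) j ^ 2 = 1 := by simp [Pi.single_apply]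
  simp_rw [e] at h1
  rw [e2, mul_one] at h1
  exact (Finset.single_le_sum (f := fun s => centredGrad κ H Z i s ^ 2) (fun _ _ => sq_nonneg _)
    (Finset.mem_univ t)).trans h1

end CentreRows

/-! ### Exchangeable periods and the size of the linear term -/

namespace ErrorModel

set_option linter.unusedSectionVars false

variable {Ω : Type*} [mΩ : MeasurableSpace Ω] {P : Measure Ω} [IsProbabilityMeasure P]
  {ν : ℕ → ℕ → Ω → ℝ} {A v : ℝ}

/-- The periods are exchangeable. -/
lemma identDistrib_perm (h : ErrorModel P ν A v) {T : ℕ} (π : Equiv.Perm (Fin T)) :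
    IdentDistrib (fun (ω : Ω) (t : Fin T) (i : ℕ) => ν i t ω)
      (fun (ω : Ω) (t : Fin T) (i : ℕ) => ν i (π t) ω) P P := by
  have hm (t : ℕ) : Measurable fun (ω : Ω) (i : ℕ) => ν i t ω :=
    measurable_pi_lambda _ fun i => h.measurable i t
  have h1 : iIndepFun (fun (t : Fin T) (ω : Ω) (i : ℕ) => ν i t ω) P :=
    h.indep_time.precomp (g := fun t : Fin T => (t : ℕ)) Fin.val_injective
  have h2 : iIndepFun (fun (t : Fin T) (ω : Ω) (i : ℕ) => ν i (π t) ω) P :=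
    h.indep_time.precomp (g := fun t : Fin T => (π t : ℕ)) (Fin.val_injective.comp π.injective)
  refine ⟨(measurable_pi_lambda _ fun t : Fin T => hm t).aemeasurable,
    (measurable_pi_lambda _ fun t : Fin T => hm (π t)).aemeasurable, ?_⟩
  rw [(iIndepFun_iff_map_fun_eq_pi_map fun t : Fin T => (hm t).aemeasurable).1 h1,
    (iIndepFun_iff_map_fun_eq_pi_map fun t : Fin T => (hm (π t)).aemeasurable).1 h2]
  congr 1
  ext1 t
  exact (h.identDistrib t (π t)).map_eq

lemma integral_perm (h : ErrorModel P ν A v) {n T : ℕ} (π : Equiv.Perm (Fin T))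
    {Φ : Matrix (Fin n) (Fin T) ℝ → ℝ}
    (hΦ : Measurable fun q : Fin T → ℕ → ℝ => Φ (of fun (i : Fin n) t => q t i)) :
    ∫ ω, Φ (panel n T fun i t => ν i t ω) ∂P
      = ∫ ω, Φ ((panel n T fun i t => ν i t ω).submatrix id π) ∂P :=
  ((h.identDistrib_perm π).comp hΦ).integral_eq

/-- The gradient is nearly orthogonal to every fixed matrix with centred rows. -/
theorem integral_finner_centredGrad_sq_le (h : ErrorModel P ν A v) {n T : ℕ} (hT : 2 ≤ T)
    {κ H K : ℝ} (hκ : 0 < κ) (hK : 0 ≤ K) (hHK : H * T ≤ κ ^ 4 * K ^ 8)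
    (U : Matrix (Fin n) (Fin T) ℝ) (hU : ∀ i, ∑ t, U i t = 0) (hU1 : frob U = 1) :
    Integrable (fun ω => finner U (centredGrad κ H (panel n T fun i t => ν i t ω)) ^ 2) P ∧
      ∫ ω, finner U (centredGrad κ H (panel n T fun i t => ν i t ω)) ^ 2 ∂P
        ≤ 8 * K ^ 14 / (κ * T ^ 2) := by
  have hT0 : 0 < T := by omega
  have hT' : (2 : ℝ) ≤ T := by exact_mod_cast hT
  set B := 4 * K ^ 14 / (κ * T) with hBdef
  have hmβ (i : Fin n) (t : Fin T) : Measurable fun q : Fin T → ℕ → ℝ =>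
      centredGrad κ H (of fun (i : Fin n) (t : Fin T) => q t i) i t :=
    measurable_centredGrad (fun i t => (measurable_pi_apply (i : ℕ)).comp (measurable_pi_apply t))
      i t
  have hmω (i : Fin n) (t : Fin T) :
      Measurable fun ω => centredGrad κ H (panel n T fun i t => ν i t ω) i t :=
    measurable_centredGrad (fun i t => h.measurable i t) i t
  have hperm (i j : Fin n) (s t : Fin T) (π : Equiv.Perm (Fin T)) :
      ∫ ω, centredGrad κ H (panel n T fun i t => ν i t ω) i s
          * centredGrad κ H (panel n T fun i t => ν i t ω) j t ∂P
        = ∫ ω, centredGrad κ H (panel n T fun i t => ν i t ω) i (π s)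
          * centredGrad κ H (panel n T fun i t => ν i t ω) j (π t) ∂P := by
    have := h.integral_perm π (Φ := fun Z => centredGrad κ H Z i s * centredGrad κ H Z j t)
      ((hmβ i s).mul (hmβ j t))
    simpa only [centredGrad_submatrix] using this
  have hbd (ω : Ω) (i : Fin n) (t : Fin T) :=
    abs_centredGrad_le hκ hT0 hK hHK (panel n T fun i t => ν i t ω) i t
  -- A transposition matches the diagonal moments; double transitivity of the permutations matches
  -- the off-diagonal ones.
  have key := integral_sq_sum_mul_le_of_exchangeable (P := P) hT
    (b := fun i t ω => centredGrad κ H (panel n T fun i t => ν i t ω) i t) (B := B)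
    (fun i j s t => Integrable.mono' (integrable_const (√B * √B))
      ((hmω i s).mul (hmω j t)).aestronglyMeasurable (ae_of_all _ fun ω => by
        rw [Real.norm_eq_abs, abs_mul]
        exact mul_le_mul (hbd ω i s) (hbd ω j t) (abs_nonneg _) (Real.sqrt_nonneg _)))
    (fun i j s s' => by
      have := hperm i j s s (Equiv.swap s s')
      rwa [Equiv.swap_apply_left] at this)
    (fun i j s t s' t' hst hst' => by
      obtain ⟨π, h1, h2⟩ := exists_perm_apply_eq hst hst'
      have := hperm i j s t π
      rwa [h1, h2] at this)
    (fun i ω => sum_centredGrad _ _ _ i)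
    (fun ω x => sum_mul_centredGrad_sq_le hκ hT0 hK hHK _ x) U hU
  refine ⟨key.1, key.2.trans ?_⟩
  have h4 : (0 : ℝ) < T - 1 := by linarith
  rw [hU1, one_pow, mul_one, hBdef, div_div, div_le_div_iff₀ (by positivity) (by positivity)]
  have h3 : (T : ℝ) ≤ 2 * (T - 1) := by linarith
  calc 4 * K ^ 14 * (κ * T ^ 2) = 4 * K ^ 14 * (κ * T) * T := by ring
    _ ≤ 4 * K ^ 14 * (κ * T) * (2 * (T - 1)) := by gcongr
    _ = _ := by ring

end ErrorModel

/-! ### The bound for fixed regressors -/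

lemma frob_neg {ι τ : Type*} [Fintype ι] [Fintype τ] (X : Matrix ι τ ℝ) : frob (-X) = frob X := by
  simp [frob]

lemma frob_smul {ι τ : Type*} [Fintype ι] [Fintype τ] (c : ℝ) (X : Matrix ι τ ℝ) :
    frob (c • X) = |c| * frob X := by
  rw [frob, frob, ← Real.sqrt_sq_eq_abs, ← Real.sqrt_mul (sq_nonneg c)]
  simp [mul_pow, Finset.mul_sum]

lemma frob_sum_le {ι τ κ : Type*} [Fintype ι] [Fintype τ] (s : Finset κ) (X : κ → Matrix ι τ ℝ) :
    frob (∑ l ∈ s, X l) ≤ ∑ l ∈ s, frob (X l) := by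
  classical
  induction s using Finset.induction_on with
  | empty => simp [frob]
  | insert a s ha ih =>
    rw [Finset.sum_insert ha, Finset.sum_insert ha]
    exact (frob_add_le _ _).trans (by gcongr)

/-- The deterministic core: `p` bounds the projection coefficients and `q` the pairings of the
gradient with the directions, so the linear term is at most `8 k p q`. -/
lemma abs_trace_rowCorr_add_projection_sub_le {k n T : ℕ} {κ H K p q : ℝ} (hκ : 0 < κ)
    (hT : 0 < T) (hK : 1 ≤ K) (hHK : H * T ≤ κ ^ 4 * K ^ 8) {Z : Matrix (Fin n) (Fin T) ℝ}
    (hZ : WellConditioned κ H Z) {U : Fin k → Matrix (Fin n) (Fin T) ℝ} (hU : ∀ l, frob (U l) = 1)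
    {c : Fin k → ℝ} (hp0 : 0 ≤ p) (hp : ∀ l, |c l| ≤ p)
    (hq : ∀ l, |finner (U l) (centredGrad κ H Z)| ≤ q) (hpT : 2 * (k * p) ≤ √(κ * T)) :
    |(rowCorr (centreRows Z + -∑ l, c l • U l) ^ 4).trace - (rowCorr (centreRows Z) ^ 4).trace|
      ≤ 8 * (k * p * q) + 1100 * K ^ 6 * (k * p) ^ 2 / (κ * T) := by
  have hT' : (0 : ℝ) < T := by exact_mod_cast hT
  have hρ : 0 < √(κ * T) := by positivity
  set D := -∑ l, c l • U l with hD
  have hDle : frob D ≤ k * p := by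
    rw [hD, frob_neg]
    refine (frob_sum_le _ _).trans ?_
    simp_rw [frob_smul, hU, mul_one]
    refine (Finset.sum_le_sum fun l _ => hp l).trans ?_
    simp
  have h1 := abs_trace_rowCorr_add_sub_le hρ hZ.le_rowNorm (D := D) (by linarith)
    (hZ.opNorm_normRows_le hκ hT (by linarith) hHK) hK
  have h2 : |finner (corrGrad (centreRows Z)) D| ≤ k * p * q := by
    rw [hD, finner_neg_right, abs_neg, finner_sum_right]
    refine (Finset.abs_sum_le_sum_abs _ _).trans ?_
    calc _ ≤ ∑ _l : Fin k, p * q := by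
          refine Finset.sum_le_sum fun l _ => ?_
          have h3 := hq l
          rw [centredGrad, if_pos hZ, finner_comm] at h3
          rw [finner_smul_right, abs_mul]
          exact mul_le_mul (hp l) h3 (abs_nonneg _) hp0
      _ = _ := by simp [mul_assoc]
  have h4 : 1100 * K ^ 6 * (frob D / √(κ * T)) ^ 2 ≤ 1100 * K ^ 6 * (k * p) ^ 2 / (κ * T) := by
    rw [div_pow, Real.sq_sqrt (by positivity), ← mul_div_assoc]
    have := frob_nonneg D
    gcongr
  rw [abs_le] at *
  constructor <;> linarith

namespace ErrorModel

variable {Ω : Type*} [mΩ : MeasurableSpace Ω] {P : Measure Ω} [IsProbabilityMeasure P]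
  {ν : ℕ → ℕ → Ω → ℝ} {A v : ℝ}

lemma measureReal_exists_le_abs_le {k : ℕ} {X : Fin k → Ω → ℝ} {B b : ℝ} (hb : 0 < b)
    (hX : ∀ l, Integrable (fun ω => X l ω ^ 2) P) (hB : ∀ l, ∫ ω, X l ω ^ 2 ∂P ≤ B) :
    P.real {ω | ∃ l, b ≤ |X l ω|} ≤ k * (B / b ^ 2) := by
  have hsub : {ω | ∃ l, b ≤ |X l ω|} ⊆ ⋃ l ∈ (Finset.univ : Finset (Fin k)), {ω | b ≤ |X l ω|} := by
    rintro ω ⟨l, hl⟩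
    simp only [Set.mem_iUnion]
    exact ⟨l, Finset.mem_univ l, hl⟩
  refine (measureReal_mono hsub (measure_ne_top _ _)).trans
    ((measureReal_biUnion_finset_le _ _).trans ?_)
  refine (Finset.sum_le_sum fun l _ => measureReal_le_of_integral_sq_le hb (hX l) (hB l)).trans ?_
  simp

/-- For fixed regressors, the correlation statistic of the residuals differs from that of the
errors by a quantity that is small in probability. -/
lemma measureReal_trace_sub_le (h : ErrorModel P ν A v) {k n T : ℕ} (hT : 2 ≤ T)
    {C a H K p q ε : ℝ} (hn : (n : ℝ) ≤ C * T) (ha : 0 < a) (haC : 2 * A * C ≤ a) (hH : 0 < H)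
    (hK : 1 ≤ K) (hHK : H * T ≤ (v / 16) ^ 4 * K ^ 8) (hp : 0 < p) (hq : 0 < q)
    (hpT : 2 * (k * p) ≤ √(v / 16 * T))
    (hε : 8 * (k * p * q) + 1100 * K ^ 6 * (k * p) ^ 2 / (v / 16 * T) < ε)
    (x : ℕ → ℕ → Fin k → ℝ) (hG : IsUnit (gram n T x)) :
    P.real {ω | ε ≤ |(rowCorr (panel n T (residual n T (fun i t => ν i t ω) x)) ^ 4).trace
        - (rowCorr (centeredPanel n T fun i t => ν i t ω) ^ 4).trace|}
      ≤ n * Real.exp (-(v ^ 2 / (64 * A)) * T)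
        + (4 * A * C / a ^ 2 + C * a ^ 4 * Real.exp (15 * A / a) / H)
        + k * (A / p ^ 2) + k * (8 * K ^ 14 / (v / 16 * T ^ 2) / q ^ 2) := by
  have hκ : 0 < v / 16 := by linarith [h.var_pos]
  obtain ⟨U, hU1, hU0, hUres⟩ := exists_residual_eq_sub_projection n T x hG
  have b1 := h.measureReal_exists_rowNorm_lt_le n hT
  have b2 := h.measureReal_trace_gt_le (n := n) (by omega : 0 < T) hn ha haC hH
  have b3 := measureReal_exists_le_abs_le (P := P) hp
    (fun l => (h.integral_finner_sq_le (U l)).1)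
    (fun l => by simpa [hU1 l] using (h.integral_finner_sq_le (U l)).2)
  have b4 := measureReal_exists_le_abs_le (P := P) hq
    (fun l => (h.integral_finner_centredGrad_sq_le hT hκ (by linarith) hHK (U l) (hU0 l)
      (hU1 l)).1)
    (fun l => (h.integral_finner_centredGrad_sq_le hT hκ (by linarith) hHK (U l) (hU0 l)
      (hU1 l)).2)
  refine le_trans (measureReal_mono ?_ (measure_ne_top _ _)) ((measureReal_union_le _ _).trans
    (add_le_add ((measureReal_union_le _ _).trans
      (add_le_add ((measureReal_union_le _ _).trans (add_le_add b1 b2)) b3)) b4))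
  -- Off the four exceptional events the panel is well-conditioned and the deterministic bound
  -- contradicts a deviation of size `ε`.
  intro ω hω
  by_contra hc
  simp only [Set.mem_union, Set.mem_ofPred_eq, not_or, not_exists, not_lt, not_le] at hc hω
  obtain ⟨⟨⟨c1, c2⟩, c3⟩, c4⟩ := hc
  rw [hUres, centeredPanel_eq_centreRows] at hω
  rw [centeredPanel_eq_centreRows] at c1
  have key := abs_trace_rowCorr_add_projection_sub_le hκ (by omega : 0 < T) hK hHK ⟨c1, c2⟩ hU1
    hp.le (fun l => (c3 l).le) (fun l => (c4 l).le) hpT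
  linarith

/-- The bound is uniform over the regressors. -/
theorem eventually_forall_measureReal_trace_sub_le (h : ErrorModel P ν A v) (k : ℕ) {n : ℕ → ℕ}
    {C : ℝ} (hC : 0 < C) (hn : ∀ᶠ T in atTop, (n T : ℝ) ≤ C * T) {ε δ : ℝ} (hε : 0 < ε)
    (hδ : 0 < δ) : ∀ᶠ T in atTop, ∀ x : ℕ → ℕ → Fin k → ℝ, IsUnit (gram (n T) T x) →
      P.real {ω | ε ≤ |(rowCorr (panel (n T) T (residual (n T) T (fun i t => ν i t ω) x)) ^ 4).trace
        - (rowCorr (centeredPanel (n T) T fun i t => ν i t ω) ^ 4).trace|} ≤ δ := by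
  have hA := h.bound_pos
  have hv := h.var_pos
  obtain ⟨κ, hκ⟩ : ∃ κ, κ = v / 16 := ⟨_, rfl⟩
  have hκ0 : 0 < κ := by rw [hκ]; positivity
  -- Each of the five probability terms receives `δ / 5`, and the linear and quadratic terms receive
  -- `ε / 2` each. The constants `a`, `H`, `p`, `q`, `g` are chosen in this order, free of `T` and
  -- of the regressors.
  obtain ⟨a, ha1, haC, e1⟩ : ∃ a : ℝ, 1 ≤ a ∧ 2 * A * C ≤ a ∧ 4 * A * C / a ^ 2 ≤ δ / 5 := by
    have h1 : 0 ≤ 2 * A * C := by positivity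
    have h2 : 0 ≤ 20 * A * C / δ := by positivity
    refine ⟨2 * A * C + 1 + 20 * A * C / δ, by linarith, by linarith, ?_⟩
    have h3 : 20 * A * C / δ ≤ 2 * A * C + 1 + 20 * A * C / δ := by linarith
    have h4 : 1 ≤ 2 * A * C + 1 + 20 * A * C / δ := by linarith
    generalize 2 * A * C + 1 + 20 * A * C / δ = a at *
    rw [div_le_iff₀ hδ] at h3
    rw [div_le_iff₀ (by positivity)]
    have h5 : a ≤ a ^ 2 := le_self_pow₀ h4 two_ne_zero
    nlinarith
  obtain ⟨H, hH0, e2⟩ : ∃ H : ℝ, 0 < H ∧ C * a ^ 4 * Real.exp (15 * A / a) / H = δ / 5 := by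
    refine ⟨5 * (C * a ^ 4 * Real.exp (15 * A / a)) / δ, by positivity, ?_⟩
    field_simp
  obtain ⟨p, hp1, e3⟩ : ∃ p : ℝ, 1 ≤ p ∧ k * (A / p ^ 2) ≤ δ / 5 := by
    have h1 : 0 ≤ 5 * k * A / δ := by positivity
    refine ⟨1 + 5 * k * A / δ, by linarith, ?_⟩
    have h2 : 5 * k * A / δ ≤ 1 + 5 * k * A / δ := by linarith
    have h3 : 1 ≤ 1 + 5 * k * A / δ := by linarith
    generalize 1 + 5 * k * A / δ = p at *
    rw [div_le_iff₀ hδ] at h2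
    rw [← mul_div_assoc, div_le_iff₀ (by positivity)]
    have h5 : p ≤ p ^ 2 := le_self_pow₀ h3 two_ne_zero
    nlinarith
  obtain ⟨q, hq0, e4⟩ : ∃ q : ℝ, 0 < q ∧ 8 * (k * p * q) ≤ ε / 2 := by
    have h1 : 0 ≤ k * p := by positivity
    refine ⟨ε / (16 * (k * p + 1)), by positivity, ?_⟩
    rw [← mul_div_assoc, ← mul_div_assoc, div_le_iff₀ (by positivity)]
    nlinarith
  obtain ⟨g, hg1, hg8⟩ : ∃ g : ℝ, 1 ≤ g ∧ H ≤ κ ^ 4 * g ^ 8 := by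
    have h0 : 0 ≤ H / κ ^ 4 := by positivity
    refine ⟨1 + H / κ ^ 4, by linarith, ?_⟩
    calc H = κ ^ 4 * (H / κ ^ 4) := by field_simp
      _ ≤ κ ^ 4 * (1 + H / κ ^ 4) ^ 8 := by
        gcongr
        exact (by linarith : H / κ ^ 4 ≤ 1 + H / κ ^ 4).trans
          (le_self_pow₀ (by linarith) (by norm_num))
  -- With `K = g s` and `T = s ^ 8`, both `K ^ 14 / T ^ 2` and `K ^ 6 / T` are constants times `s ^
  -- (-2)`.
  obtain ⟨s, hs8, hsT⟩ : ∃ s : ℕ → ℝ, (∀ T, s T ^ 8 = T) ∧ Tendsto s atTop atTop := by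
    refine ⟨fun T => (T : ℝ) ^ (1 / 8 : ℝ), fun T => ?_,
      (tendsto_rpow_atTop (by norm_num)).comp tendsto_natCast_atTop_atTop⟩
    rw [← Real.rpow_natCast, ← Real.rpow_mul (Nat.cast_nonneg T)]
    norm_num
  have hs2 : Tendsto (fun T => (s T ^ 2)⁻¹) atTop (𝓝 0) :=
    ((tendsto_pow_atTop two_ne_zero).comp hsT).inv_tendsto_atTop
  have l1 : ∀ᶠ T : ℕ in atTop, k * (8 * g ^ 14 / κ / q ^ 2) * (s T ^ 2)⁻¹ < δ / 5 := by
    have := hs2.const_mul (k * (8 * g ^ 14 / κ / q ^ 2))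
    rw [mul_zero] at this
    exact this.eventually_lt_const (by positivity)
  have l2 : ∀ᶠ T : ℕ in atTop, 1100 * g ^ 6 * (k * p) ^ 2 / κ * (s T ^ 2)⁻¹ < ε / 2 := by
    have := hs2.const_mul (1100 * g ^ 6 * (k * p) ^ 2 / κ)
    rw [mul_zero] at this
    exact this.eventually_lt_const (by positivity)
  have l3 : ∀ᶠ T : ℕ in atTop, C * (T * Real.exp (-(v ^ 2 / (64 * A)) * T)) < δ / 5 := by
    have h1 := (tendsto_rpow_mul_exp_neg_mul_atTop_nhds_zero 1 (v ^ 2 / (64 * A))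
      (by positivity)).comp tendsto_natCast_atTop_atTop
    have h2 := h1.const_mul C
    rw [mul_zero] at h2
    refine (h2.eventually_lt_const (by positivity : 0 < δ / 5)).mono fun T hT => ?_
    simpa using hT
  have l4 : ∀ᶠ T : ℕ in atTop, (2 * (k * p)) ^ 2 ≤ κ * T :=
    (tendsto_natCast_atTop_atTop.const_mul_atTop hκ0).eventually_ge_atTop _
  filter_upwards [l1, l2, l3, l4, hn, eventually_ge_atTop 2, hsT.eventually_ge_atTop 1]
    with T m1 m2 m3 m4 hnT hT hs1 x hG
  have hs0 : 0 < s T := by linarith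
  have hT8 := hs8 T
  have hmain := h.measureReal_trace_sub_le (H := H) (p := p) (q := q) (n := n T)
    (K := g * s T) (ε := ε) hT hnT (by linarith : 0 < a) haC hH0 (one_le_mul_of_one_le_of_one_le hg1 hs1)
    (by
      rw [mul_pow, hT8, ← mul_assoc, ← hκ]
      gcongr) (by linarith : 0 < p) hq0 (by rw [← hκ]; exact Real.le_sqrt_of_sq_le m4)
    (by
      have e : 1100 * (g * s T) ^ 6 * (k * p) ^ 2 / (κ * T)
          = 1100 * g ^ 6 * (k * p) ^ 2 / κ * (s T ^ 2)⁻¹ := by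
        rw [← hT8]
        field_simp
      rw [← hκ, e]
      linarith) x hG
  refine hmain.trans ?_
  have e5 : k * (8 * (g * s T) ^ 14 / (κ * T ^ 2) / q ^ 2)
      = k * (8 * g ^ 14 / κ / q ^ 2) * (s T ^ 2)⁻¹ := by
    rw [← hT8]
    field_simp
  have e6 : n T * Real.exp (-(v ^ 2 / (64 * A)) * T)
      ≤ C * (T * Real.exp (-(v ^ 2 / (64 * A)) * T)) := by
    rw [← mul_assoc]
    gcongr
  rw [← hκ, e5, e2]
  linarith

end ErrorModel

/-! ### Measurability of the residuals in regressors and errors -/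

section MeasurableResidual

variable {Ω : Type*} [MeasurableSpace Ω]

lemma measurable_det {ι : Type*} [Fintype ι] [DecidableEq ι] {F : Ω → Matrix ι ι ℝ}
    (hF : ∀ i j, Measurable fun ω => F ω i j) : Measurable fun ω => (F ω).det := by
  simp_rw [det_apply]
  exact Finset.measurable_sum _ fun σ _ =>
    (Finset.measurable_prod _ fun i _ => hF (σ i) i).const_smul _

lemma measurable_matrix_inv {ι : Type*} [Fintype ι] [DecidableEq ι] {F : Ω → Matrix ι ι ℝ}
    (hF : ∀ i j, Measurable fun ω => F ω i j) (i j : ι) :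
    Measurable fun ω => (F ω)⁻¹ i j := by
  simp_rw [inv_def, Matrix.smul_apply, smul_eq_mul, Ring.inverse_eq_inv', adjugate_apply]
  refine (measurable_det hF).inv.mul (measurable_det fun a b => ?_)
  simp_rw [updateRow_apply]
  split_ifs
  · exact measurable_const
  · exact hF a b

variable {k : ℕ} {x : ℕ → ℕ → Ω → Fin k → ℝ} {η : ℕ → ℕ → Ω → ℝ}

lemma measurable_centered {z : ℕ → Ω → ℝ} (hz : ∀ t, Measurable (z t)) (T t : ℕ) :
    Measurable fun ω => centered T (fun t => z t ω) t :=
  (hz t).sub ((Finset.measurable_sum _ fun s _ => hz s).const_mul _)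

lemma measurable_centered_apply (hx : ∀ i t, Measurable (x i t)) (T i t : ℕ) (l : Fin k) :
    Measurable fun ω => centered T (fun t => x i t ω) t l := by
  simp_rw [centered_apply]
  exact measurable_centered (fun t => (measurable_pi_apply l).comp (hx i t)) T t

lemma measurable_gram (hx : ∀ i t, Measurable (x i t)) (n T : ℕ) (l m : Fin k) :
    Measurable fun ω => gram n T (fun i t => x i t ω) l m := by
  simp_rw [gram, Matrix.sum_apply, vecMulVec_apply]
  exact Finset.measurable_sum _ fun t _ => Finset.measurable_sum _ fun i _ =>
    (measurable_centered_apply hx T i t l).mul (measurable_centered_apply hx T i t m)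

lemma measurableSet_isUnit_gram (hx : ∀ i t, Measurable (x i t)) (n T : ℕ) :
    MeasurableSet {ω | IsUnit (gram n T fun i t => x i t ω)} := by
  simp_rw [isUnit_iff_isUnit_det, isUnit_iff_ne_zero]
  exact (measurable_det (measurable_gram hx n T)) (measurableSet_singleton 0).compl

lemma measurable_residual (hx : ∀ i t, Measurable (x i t)) (hη : ∀ i t, Measurable (η i t))
    (n T i t : ℕ) :
    Measurable fun ω => residual n T (fun i t => η i t ω) (fun i t => x i t ω) i t := by
  have hc (i t : ℕ) := measurable_centered (hη i) T t
  have hols (l : Fin k) :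
      Measurable fun ω => olsEstimator n T (fun i t => η i t ω) (fun i t => x i t ω) l := by
    simp_rw [olsEstimator, mulVec, dotProduct, Finset.sum_apply, Pi.smul_apply, smul_eq_mul]
    exact Finset.measurable_sum _ fun m _ =>
      (measurable_matrix_inv (measurable_gram hx n T) l m).mul
        (Finset.measurable_sum _ fun t _ => Finset.measurable_sum _ fun i _ =>
          (hc i t).mul (measurable_centered_apply hx T i t m))
  exact (hc i t).sub (Finset.measurable_sum _ fun l _ =>
    (measurable_centered_apply hx T i t l).mul (hols l))

end MeasurableResidual

/-! ### Random regressors -/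

variable {Ω : Type*} [MeasurableSpace Ω] {P : Measure Ω} [IsProbabilityMeasure P]

/-- The joint law is a product, so a bound valid for every fixed value of `X` integrates to the same
bound. -/
lemma measure_le_of_indepFun {α β : Type*} [MeasurableSpace α] [MeasurableSpace β]
    {X : Ω → α} {Y : Ω → β} (h : IndepFun X Y P) (hX : Measurable X) (hY : Measurable Y)
    {S : Set (α × β)} (hS : MeasurableSet S) {d : ENNReal}
    (hd : ∀ a, P {ω | (a, Y ω) ∈ S} ≤ d) : P {ω | (X ω, Y ω) ∈ S} ≤ d := by
  have h1 : P {ω | (X ω, Y ω) ∈ S} = (P.map X).prod (P.map Y) S := by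
    rw [← (indepFun_iff_map_prod_eq_prod_map_map hX.aemeasurable hY.aemeasurable).1 h,
      Measure.map_apply (hX.prodMk hY) hS]
    rfl
  have : IsProbabilityMeasure (P.map X) := Measure.isProbabilityMeasure_map hX.aemeasurable
  have : IsProbabilityMeasure (P.map Y) := Measure.isProbabilityMeasure_map hY.aemeasurable
  rw [h1, Measure.prod_apply hS]
  calc ∫⁻ a, P.map Y (Prod.mk a ⁻¹' S) ∂P.map X ≤ ∫⁻ _a, d ∂P.map X := by
        refine lintegral_mono fun a => ?_
        rw [Measure.map_apply hY (measurable_prodMk_left hS)]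
        exact hd a
    _ = d := by simp

lemma exists_errorModel {ν : ℕ → ℕ → Ω → ℝ} (hB1 : AssumptionB1 P ν) (hH0 : NullHypothesis P ν)
    {v : ℝ} (hv : 0 < v) (hvar : ∀ i t, v ≤ ∫ ω, ν i t ω ^ 2 ∂P) :
    ∃ A, ErrorModel P ν A v := by
  obtain ⟨C₂, hC₂, h6⟩ := hB1.sixth_moment
  have hi (i t : ℕ) : Integrable (fun ω => 1 + |ν i t ω| ^ 6) P :=
    (integrable_const 1).add (h6 i t).1
  have hle (i t : ℕ) : ∫ ω, (1 + |ν i t ω| ^ 6) ∂P ≤ 1 + C₂ := by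
    rw [integral_add (integrable_const 1) (h6 i t).1]
    simpa using (h6 i t).2
  -- With `w = z ^ 2 ≥ 0` this is `w ^ 2 ≤ 1 + w ^ 3`.
  have p4 (z : ℝ) : z ^ 4 ≤ 1 + |z| ^ 6 := by
    have h1 : |z| ^ 6 = (z ^ 2) ^ 3 := by rw [← sq_abs]; ring
    have h2 : z ^ 4 = (z ^ 2) ^ 2 := by ring
    rw [h1, h2]
    have := sq_nonneg z
    generalize z ^ 2 = w at *
    nlinarith [mul_nonneg this (sq_nonneg (w - 1)), sq_nonneg (w - 1)]
  have p2 (z : ℝ) : z ^ 2 ≤ 1 + |z| ^ 6 := by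
    have h1 : |z| ^ 6 = (z ^ 2) ^ 3 := by rw [← sq_abs]; ring
    rw [h1]
    have := sq_nonneg z
    generalize z ^ 2 = w at *
    nlinarith [mul_nonneg this (sq_nonneg (w - 1)), sq_nonneg (w - 1)]
  have i4 (i t : ℕ) : Integrable (fun ω => ν i t ω ^ 4) P :=
    Integrable.mono' (hi i t) ((hB1.measurable i t).pow_const 4).aestronglyMeasurable
      (ae_of_all _ fun ω => by
        rw [Real.norm_eq_abs, abs_of_nonneg (by positivity)]
        exact p4 _)
  have i2 (i t : ℕ) : Integrable (fun ω => ν i t ω ^ 2) P :=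
    Integrable.mono' (hi i t) ((hB1.measurable i t).pow_const 2).aestronglyMeasurable
      (ae_of_all _ fun ω => by
        rw [Real.norm_eq_abs, abs_of_nonneg (by positivity)]
        exact p2 _)
  exact ⟨1 + C₂, hB1.measurable, hB1.indep, hH0, hB1.identDistrib, hB1.mean_zero, i4,
    fun i t => (integral_mono (i4 i t) (hi i t) fun ω => p4 _).trans (hle i t),
    fun i t => (integral_mono (i2 i t) (hi i t) fun ω => p2 _).trans (hle i t),
    hvar, by linarith, hv⟩

/-- Random regressors independent of the errors. -/
theorem ErrorModel.eventually_measure_trace_sub_le {ν : ℕ → ℕ → Ω → ℝ} {A v : ℝ}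
    (h : ErrorModel P ν A v) {k : ℕ} {x : ℕ → ℕ → Ω → Fin k → ℝ}
    (hx : ∀ i t, Measurable (x i t))
    (hind : IndepFun (fun (ω : Ω) (p : ℕ × ℕ) => x p.1 p.2 ω)
      (fun (ω : Ω) (p : ℕ × ℕ) => ν p.1 p.2 ω) P) {n : ℕ → ℕ}
    {C : ℝ} (hC : 0 < C) (hn : ∀ᶠ T in atTop, (n T : ℝ) ≤ C * T) {ε δ : ℝ} (hε : 0 < ε)
    (hδ : 0 < δ) : ∀ᶠ T in atTop, P {ω | IsUnit (gram (n T) T fun i t => x i t ω) ∧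
      ε ≤ |(rowCorr (panel (n T) T
          (residual (n T) T (fun i t => ν i t ω) fun i t => x i t ω)) ^ 4).trace
        - (rowCorr (centeredPanel (n T) T fun i t => ν i t ω) ^ 4).trace|}
      ≤ ENNReal.ofReal δ := by
  filter_upwards [h.eventually_forall_measureReal_trace_sub_le k hC hn hε hδ] with T hT
  set S : Set ((ℕ × ℕ → Fin k → ℝ) × (ℕ × ℕ → ℝ)) :=
    {q | IsUnit (gram (n T) T fun i t => q.1 (i, t)) ∧
      ε ≤ |(rowCorr (panel (n T) T
          (residual (n T) T (fun i t => q.2 (i, t)) fun i t => q.1 (i, t))) ^ 4).trace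
        - (rowCorr (centeredPanel (n T) T fun i t => q.2 (i, t)) ^ 4).trace|} with hS
  have m1 (i t : ℕ) : Measurable fun q : (ℕ × ℕ → Fin k → ℝ) × (ℕ × ℕ → ℝ) => q.1 (i, t) :=
    (measurable_pi_apply (i, t)).comp measurable_fst
  have m2 (i t : ℕ) : Measurable fun q : (ℕ × ℕ → Fin k → ℝ) × (ℕ × ℕ → ℝ) => q.2 (i, t) :=
    (measurable_pi_apply (i, t)).comp measurable_snd
  have hSm : MeasurableSet S := by
    suffices hF : Measurable fun q : (ℕ × ℕ → Fin k → ℝ) × (ℕ × ℕ → ℝ) =>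
        |(rowCorr (panel (n T) T
          (residual (n T) T (fun i t => q.2 (i, t)) fun i t => q.1 (i, t))) ^ 4).trace
        - (rowCorr (centeredPanel (n T) T fun i t => q.2 (i, t)) ^ 4).trace| from
      (measurableSet_isUnit_gram m1 (n T) T).inter (measurableSet_le measurable_const hF)
    refine Measurable.abs (Measurable.sub ?_ ?_)
    · exact measurable_trace_rowCorr_pow (ι := Fin (n T)) (τ := Fin T)
        (fun i t => measurable_residual m1 m2 (n T) T i t) 4
    · exact measurable_trace_rowCorr_pow (ι := Fin (n T)) (τ := Fin T)
        (fun i t => measurable_centered (m2 i) T t) 4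
  refine measure_le_of_indepFun hind
    (measurable_pi_lambda _ fun p => hx p.1 p.2)
    (measurable_pi_lambda _ fun p => h.measurable p.1 p.2) hSm fun ξ => ?_
  by_cases hG : IsUnit (gram (n T) T fun i t => ξ (i, t))
  · have h1 := hT (fun i t => ξ (i, t)) hG
    rw [measureReal_def, ← ENNReal.le_ofReal_iff_toReal_le (measure_ne_top _ _) hδ.le] at h1
    refine le_trans (measure_mono ?_) h1
    rintro ω ⟨-, hω⟩
    exact hω
  -- For a singular design the section is empty, because invertibility is part of the event.
  · refine le_of_eq_of_le ?_ zero_le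
    rw [measure_eq_zero_iff_ae_notMem]
    exact ae_of_all _ fun ω hω => hG hω.1

/-- The indicators of singularity vanish eventually almost surely, so their expectations tend to
zero on a finite measure space. -/
lemma tendsto_measure_not_isUnit_gram {k : ℕ} {x : ℕ → ℕ → Ω → Fin k → ℝ}
    (hx : ∀ i t, Measurable (x i t)) (n : ℕ → ℕ)
    (hinv : ∀ᵐ ω ∂P, ∀ᶠ T : ℕ in atTop, IsUnit (gram (n T) T fun i t => x i t ω)) :
    Tendsto (fun T => P {ω | ¬IsUnit (gram (n T) T fun i t => x i t ω)}) atTop (𝓝 0) := by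
  have := tendsto_measure_of_ae_tendsto_indicator_of_isFiniteMeasure (μ := P) atTop
    (A := ∅) (As := fun T => {ω | ¬IsUnit (gram (n T) T fun i t => x i t ω)})
    MeasurableSet.empty (fun T => (measurableSet_isUnit_gram hx (n T) T).compl)
    (hinv.mono fun ω hω => hω.mono fun T hT => by simpa using hT)
  simpa using this

end Panel

end

/-! ### Conclusion -/

theorem mainTheorem4 {Ω : Type*} [MeasurableSpace Ω] (P : Measure Ω) [IsProbabilityMeasure P]
    (k : ℕ) (n : ℕ → ℕ) (c : ℝ) (hc : 0 < c)
    (hn : Tendsto (fun T : ℕ => (n T : ℝ) / (T : ℝ)) atTop (𝓝 c))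
    (α : ℝ) (β : Fin k → ℝ) (μ : ℕ → Ω → ℝ)
    (x : ℕ → ℕ → Ω → Fin k → ℝ) (ν y : ℕ → ℕ → Ω → ℝ)
    (hy : ∀ i t ω, y i t ω = α + x i t ω ⬝ᵥ β + μ i ω + ν i t ω)
    (hB1 : Panel.AssumptionB1 P ν)
    (hB2 : Panel.AssumptionB2 P n x ν)
    (hH0 : Panel.NullHypothesis P ν)
    (hvar : ∃ v : ℝ, 0 < v ∧ ∀ i t, v ≤ ∫ ω, (ν i t ω) ^ 2 ∂P)
    (hinv : ∀ᵐ ω ∂P, ∀ᶠ T : ℕ in atTop, IsUnit (Panel.gram (n T) T fun i t => x i t ω)) :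
    TendstoInMeasure P
      (fun (T : ℕ) (ω : Ω) =>
        (Panel.residualCorr (n T) T (fun i t => y i t ω) (fun i t => x i t ω) ^ 4).trace -
          (Panel.errorCorr (n T) T (fun i t => ν i t ω) ^ 4).trace)
      atTop (fun _ => 0) := by
  obtain ⟨v, hv, hvar⟩ := hvar
  obtain ⟨A, h⟩ := Panel.exists_errorModel hB1 hH0 hv hvar
  have hnC : ∀ᶠ T in atTop, (n T : ℝ) ≤ (c + 1) * T := by
    filter_upwards [hn.eventually_le_const (lt_add_one c), eventually_gt_atTop 0] with T h1 hT
    rwa [div_le_iff₀ (by exact_mod_cast hT)] at h1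
  rw [tendstoInMeasure_iff_norm]
  intro ε hε
  rw [ENNReal.tendsto_nhds_zero]
  intro d hd
  -- One `δ` is for a singular design, the other for a large deviation under an invertible one.
  obtain ⟨δ, hδ, hδd⟩ : ∃ δ : ℝ, 0 < δ ∧ ENNReal.ofReal δ + ENNReal.ofReal δ ≤ d := by
    obtain ⟨r, hr0, hrd⟩ := ENNReal.lt_iff_exists_nnreal_btwn.1 hd
    have hr : (0 : ℝ) < r := by exact_mod_cast hr0
    refine ⟨r / 2, by positivity, ?_⟩
    rw [← ENNReal.ofReal_add (by positivity) (by positivity), add_halves, ENNReal.ofReal_coe_nnreal]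
    exact hrd.le
  have hG := ENNReal.tendsto_nhds_zero.1
    (Panel.tendsto_measure_not_isUnit_gram hB2.measurable n hinv) (ENNReal.ofReal δ)
    (ENNReal.ofReal_pos.2 hδ)
  filter_upwards [hG, h.eventually_measure_trace_sub_le hB2.measurable hB2.indep
    (by linarith : 0 < c + 1) hnC hε hδ, eventually_gt_atTop 0] with T h1 h2 hT
  refine le_trans (measure_mono ?_) ((measure_union_le _ _).trans ((add_le_add h1 h2).trans hδd))
  intro ω hω
  by_cases hU : IsUnit (Panel.gram (n T) T fun i t => x i t ω)
  · right
    refine ⟨hU, ?_⟩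
    -- The intercept and the individual effect are constant in time, so they act jointly as the unit
    -- constant that centring removes.
    rw [Set.mem_ofPred_eq, sub_zero, Real.norm_eq_abs, Panel.residualCorr, Panel.errorCorr,
      Panel.sampleCorr_eq_rowCorr, Panel.sampleCorr_eq_rowCorr,
      Panel.residual_model hT (fun i => α + μ i ω) β _ (fun i t => ν i t ω) _
        (fun i t => by rw [hy]; ring) hU] at hω
    exact hω
  · left
    exact hU
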